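/- For a configuration of four points $p_1,\dots,p_4\in\mathbb{C}^2$ and $1\le i<j\le 4$ put $m_{ij}(p)=\sum_{k=1}^{2}(p_i^k-p_j^k)^2$ (no conjugation), and let $M_{2,4}\subset\mathbb{C}^6$ be the set of all vectors $(m_{ij}(p))_{i<j}$. Let $L_{2,4}\subset\mathbb{C}^6$ be the preimage of $M_{2,4}$ under the map $(l_{ij})\mapsto(l_{ij}^2)$; it is an affine variety. A point $x$ of an affine variety $V\subseteq\mathbb{C}^N$ is singular if the dimension of the Zariski tangent space $\{v\in\mathbb{C}^N : \sum_i \partial_i f(x)\,v_i=0 \text{ for all } f\in I(V)\}$ differs from the local dimension of $V$ at $x$, that is, from the largest dimension of an irreducible component of $V$ containing $x$. Then the singular locus of $L_{2,4}$ is the union of exactly $60$ distinct three-dimensional linear subspaces of $\mathbb{C}^6$, and these $60$ subspaces are precisely the three-dimensional linear subspaces of $\mathbb{C}^6$ contained in $L_{2,4}$. Moreover, $L_{2,4}$ contains no linear subspace of dimension at least $4$. -/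

import Mathlib

namespace UnsquaredMeasurement

/-- The pairs `ij` with `i < j`, indexing the coordinates of `ℂ^N`, `N = n.choose 2`. -/
abbrev Edge (n : ℕ) : Type := {e : Fin n × Fin n // e.1 < e.2}

/-- The complex squared length of every edge of a complex configuration of `n` points in `ℂ^d`
(no conjugation). -/
def squaredLengths {d n : ℕ} (p : Fin n → Fin d → ℂ) : Edge n → ℂ :=
  fun e => ∑ k : Fin d, (p e.1.1 k - p e.1.2 k) ^ 2

/-- The squared measurement variety `M_{d,n}`. -/
def M (d n : ℕ) : Set (Edge n → ℂ) :=
  Set.range (squaredLengths : (Fin n → Fin d → ℂ) → Edge n → ℂ)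

/-- The coordinatewise squaring map. -/
def squaring {σ : Type} (l : σ → ℂ) : σ → ℂ := fun e => l e ^ 2

/-- The unsquared measurement variety `L_{d,n}`: the preimage of `M_{d,n}` under squaring. -/
def L (d n : ℕ) : Set (Edge n → ℂ) := squaring ⁻¹' M d n

section Variety

variable {σ : Type}

/-- Affine varieties (algebraic subsets) of `ℂ^σ`, not necessarily irreducible. -/
def IsVariety (V : Set (σ → ℂ)) : Prop :=
  ∃ I : Ideal (MvPolynomial σ ℂ), V = MvPolynomial.zeroLocus ℂ I

/-- Irreducible varieties. -/
def IsIrreducibleVariety (V : Set (σ → ℂ)) : Prop :=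
  IsVariety V ∧ V.Nonempty ∧
    ∀ V₁ V₂ : Set (σ → ℂ), IsVariety V₁ → IsVariety V₂ → V = V₁ ∪ V₂ → V = V₁ ∨ V = V₂

/-- The components of `V`: its maximal irreducible subvarieties. -/
def components (V : Set (σ → ℂ)) : Set (Set (σ → ℂ)) :=
  {Z | Maximal (fun Y : Set (σ → ℂ) => IsIrreducibleVariety Y ∧ Y ⊆ V) Z}

/-- The dimension of a variety: the Krull dimension of its coordinate ring. -/
noncomputable def dimension (V : Set (σ → ℂ)) : WithBot ℕ∞ :=
  ringKrullDim (MvPolynomial σ ℂ ⧸ MvPolynomial.vanishingIdeal ℂ V)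

/-- The local dimension of `V` at `x`: the largest dimension of a component containing `x`. -/
noncomputable def localDimension (V : Set (σ → ℂ)) (x : σ → ℂ) : WithBot ℕ∞ :=
  ⨆ Z ∈ {Z | Z ∈ components V ∧ x ∈ Z}, dimension Z

/-- The Zariski tangent space of `V` at `x`: the vectors annihilated by the differentials at `x`
of all polynomials in `I(V)`. For `x ∈ V` this is the kernel at `x` of the Jacobian matrix of any
generating set of `I(V)`. -/
noncomputable def tangentSpace [Fintype σ] (V : Set (σ → ℂ)) (x : σ → ℂ) :
    Submodule ℂ (σ → ℂ) where
  carrier := {v | ∀ f ∈ MvPolynomial.vanishingIdeal ℂ V,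
    ∑ i, MvPolynomial.eval x (MvPolynomial.pderiv i f) * v i = 0}
  add_mem' := by
    intro v w hv hw f hf
    simp [mul_add, Finset.sum_add_distrib, hv f hf, hw f hf]
  zero_mem' := by
    intro f _
    simp
  smul_mem' := by
    intro c v hv f hf
    have h := hv f hf
    simp only [Pi.smul_apply, smul_eq_mul, mul_left_comm _ c, ← Finset.mul_sum, h, mul_zero]

/-- The singular locus: the points of `V` where the dimension of the Zariski tangent space differs
from the local dimension. -/
noncomputable def singularLocus [Fintype σ] (V : Set (σ → ℂ)) : Set (σ → ℂ) :=
  {x | x ∈ V ∧ ((Module.finrank ℂ (tangentSpace V x) : ℕ) : WithBot ℕ∞) ≠ localDimension V x}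

end Variety

end UnsquaredMeasurement

/-!
By the Cayley–Menger determinant, `L 2 4` is a hypersurface. In the coordinates `y` given by the
sums and differences of opposite edges, its equation is a sextic in `y`, which depends only on the
`yᵢ ^ 2` and on `∏ yᵢ`; it is therefore invariant under the permutations of `y` and the changes of
an even number of signs.

The sextic is irreducible, being Eisenstein on a suitable slice, so the singular locus is where its
gradient vanishes. Up to a factor, `yᵢ` times its `i`-th partial derivative is the value at `yᵢ ^ 2`
of a cubic which does not depend on `i`. The coefficients of the cubic are such that, when the
gradient vanishes, the power sums of the `yᵢ ^ 2` are those of its three roots, each taken twice.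
Hence the coordinates agree in pairs up to sign, with an even number of minus signs: there are `15`
matchings and `4` choices of signs.

Let `W` be a three-dimensional subspace of `L 2 4`. After a signed permutation, the three halved
differences `y₀ - y₁`, `y₂ - y₃`, `y₄ - y₅` are coordinates on `W`; they are the sides of a face of
a tetrahedron, and the halved sums are the opposite edges, now linear forms in the sides. Stewart's
theorem for degenerate faces shows that the squares of these forms are those of the distances from
the vertices of the face to a point above one with barycentric coordinates `α`, `β`, `γ`, and by
Heron's formula its height is zero. As the squares of linear forms are diagonal of rank one, one of
the weights is `1` and the others are `0`, and again the coordinates agree in pairs up to sign. In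
dimension at least three every point of a subspace thus lies on one of the `60` planes, so a single
plane contains the whole subspace.
-/

namespace UnsquaredMeasurement

section Gram

variable {n : ℕ}

theorem exists_gram_of_det_eq_zero {K : Type*} [Field K] [IsAlgClosed K] [NeZero (2 : K)]
    {G : Matrix (Fin (n + 1)) (Fin (n + 1)) K} (hG : G.IsSymm) (hdet : G.det = 0) :
    ∃ v : Matrix (Fin (n + 1)) (Fin n) K, G = v * v.transpose := by
  let B : LinearMap.BilinForm K (Fin (n + 1) → K) := Matrix.toBilin' G
  have : Invertible (2 : K) := invertibleOfNonzero two_ne_zero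
  obtain ⟨b', hb'⟩ := LinearMap.BilinForm.exists_orthogonal_basis
    (LinearMap.BilinForm.isSymm_iff.1 (Matrix.isSymm_toBilin'_iff_isSymm.2 hG : B.IsSymm))
  let b : Module.Basis (Fin (n + 1)) K (Fin (n + 1) → K) := b'.reindex (finCongr (by simp))
  have orthogonal : ∀ i j, i ≠ j → B (b i) (b j) = 0 := fun i j hij => by
    simp only [b, Module.Basis.reindex_apply]
    exact hb' (by simpa using hij)
  have expand : ∀ x y, B x y = ∑ i, b.repr x i * b.repr y i * B (b i) (b i) := fun x y => by
    conv_lhs => rw [← b.sum_repr x, ← b.sum_repr y]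
    simp only [map_sum, LinearMap.sum_apply, map_smul, LinearMap.smul_apply, smul_eq_mul]
    refine Finset.sum_congr rfl fun i _ => ?_
    rw [Finset.sum_eq_single i (fun j _ hj => by simp [orthogonal _ _ hj]) (by simp)]
    ring
  obtain ⟨i₀, isotropic⟩ : ∃ i, B (b i) (b i) = 0 := by
    obtain ⟨w, hw0, hw⟩ := Matrix.exists_mulVec_eq_zero_iff.2 hdet
    obtain ⟨i, hi⟩ : ∃ i, b.repr w i ≠ 0 := by
      by_contra! h
      exact hw0 (b.repr.map_eq_zero_iff.1 (Finsupp.ext h))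
    have hBw : B (b i) w = 0 := by simp [B, Matrix.toBilin'_apply', hw]
    rw [expand, Finset.sum_eq_single i (fun j _ hj => by simp [hj.symm]) (by simp)] at hBw
    exact ⟨i, by simpa [hi] using hBw⟩
  choose s hs using fun i => IsAlgClosed.exists_pow_nat_eq (B (b i) (b i)) zero_lt_two
  refine ⟨Matrix.of fun i k => b.repr (Pi.single i 1) (i₀.succAbove k) * s (i₀.succAbove k), ?_⟩
  ext i j
  have hGij : G i j = B (Pi.single i 1) (Pi.single j 1) := by simp [B, Matrix.toBilin'_single]
  rw [hGij, expand, Fin.sum_univ_succAbove _ i₀, isotropic, mul_zero, zero_add, Matrix.mul_apply]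
  refine Finset.sum_congr rfl fun k _ => ?_
  rw [Matrix.transpose_apply, Matrix.of_apply, Matrix.of_apply, ← hs]
  ring

theorem exists_gram_iff_det_eq_zero {K : Type*} [Field K] [IsAlgClosed K] [NeZero (2 : K)]
    {G : Matrix (Fin (n + 1)) (Fin (n + 1)) K} (hG : G.IsSymm) :
    (∃ v : Matrix (Fin (n + 1)) (Fin n) K, G = v * v.transpose) ↔ G.det = 0 := by
  refine ⟨?_, exists_gram_of_det_eq_zero hG⟩
  rintro ⟨v, rfl⟩
  by_contra h
  have rank_le := (Matrix.rank_mul_le_left v v.transpose).trans v.rank_le_width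
  rw [Matrix.rank_of_isUnit _ ((Matrix.isUnit_iff_isUnit_det _).2 (Ne.isUnit h)),
    Fintype.card_fin] at rank_le
  exact rank_le.not_gt n.lt_succ_self

/-- The matrix of an edge function: its extension to all pairs of vertices, symmetric and zero on
the diagonal. -/
def edgeMatrix {R : Type*} [Zero R] (m : Edge n → R) : Matrix (Fin n) (Fin n) R :=
  Matrix.of fun i j => if h : i < j then m ⟨(i, j), h⟩ else if h : j < i then m ⟨(j, i), h⟩ else 0

variable {R : Type*} [Zero R] (m : Edge n → R)

theorem edgeMatrix_of_lt {i j : Fin n} (h : i < j) : edgeMatrix m i j = m ⟨(i, j), h⟩ := by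
  simp [edgeMatrix, h]

theorem edgeMatrix_self (i : Fin n) : edgeMatrix m i i = 0 := by
  simp [edgeMatrix]

theorem edgeMatrix_comm (i j : Fin n) : edgeMatrix m i j = edgeMatrix m j i := by
  rcases lt_trichotomy i j with h | rfl | h
  · simp [edgeMatrix, h, h.not_gt]
  · rfl
  · simp [edgeMatrix, h, h.not_gt]

theorem edgeMatrix_squaredLengths {d : ℕ} (p : Fin n → Fin d → ℂ) (i j : Fin n) :
    edgeMatrix (squaredLengths p) i j = ∑ k, (p i k - p j k) ^ 2 := by
  rcases lt_trichotomy i j with h | rfl | h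
  · exact edgeMatrix_of_lt _ h
  · simp [edgeMatrix_self]
  · rw [edgeMatrix_comm, edgeMatrix_of_lt _ h, squaredLengths]
    exact Finset.sum_congr rfl fun k _ => sub_sq_comm _ _

/-- The Gram matrix, with respect to vertex `0`, of a configuration with squared edge lengths `m`,
as prescribed by the polarization identity. -/
noncomputable def gramMatrix (m : Edge (n + 1) → ℂ) : Matrix (Fin n) (Fin n) ℂ :=
  Matrix.of fun i j =>
    (edgeMatrix m 0 i.succ + edgeMatrix m 0 j.succ - edgeMatrix m i.succ j.succ) / 2

theorem isSymm_gramMatrix (m : Edge (n + 1) → ℂ) : (gramMatrix m).IsSymm :=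
  Matrix.IsSymm.ext fun i j => by
    simp only [gramMatrix, Matrix.of_apply, edgeMatrix_comm m j.succ]
    ring

theorem mem_M_iff_exists_gram {d : ℕ} {m : Edge (n + 1) → ℂ} :
    m ∈ M d (n + 1) ↔ ∃ v : Matrix (Fin n) (Fin d) ℂ, gramMatrix m = v * v.transpose := by
  constructor
  · rintro ⟨p, rfl⟩
    refine ⟨Matrix.of fun i k => p i.succ k - p 0 k, ?_⟩
    ext i j
    simp only [gramMatrix, edgeMatrix_squaredLengths, Matrix.mul_apply, Matrix.of_apply,
      Matrix.transpose_apply, ← Finset.sum_add_distrib, ← Finset.sum_sub_distrib, Finset.sum_div]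
    exact Finset.sum_congr rfl fun k _ => by ring
  · rintro ⟨v, hv⟩
    have gram_apply (i j : Fin n) : (edgeMatrix m 0 i.succ + edgeMatrix m 0 j.succ
        - edgeMatrix m i.succ j.succ) / 2 = ∑ k, v i k * v j k := congrFun₂ hv i j
    have norm_sq (i : Fin n) : edgeMatrix m 0 i.succ = ∑ k, v i k ^ 2 := by
      simpa [edgeMatrix_self, ← pow_two] using gram_apply i i
    have dist_sq (i j : Fin n) :
        ∑ k, (v i k - v j k) ^ 2 = ∑ k, v i k ^ 2 + ∑ k, v j k ^ 2 - 2 * ∑ k, v i k * v j k := by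
      rw [Finset.mul_sum, ← Finset.sum_add_distrib, ← Finset.sum_sub_distrib]
      exact Finset.sum_congr rfl fun k _ => by ring
    let p : Fin (n + 1) → Fin d → ℂ := Fin.cons 0 v
    have p_zero : p 0 = 0 := rfl
    have p_succ (i) : p i.succ = v i := rfl
    refine ⟨p, funext fun ⟨⟨i, j⟩, (hij : i < j)⟩ => ?_⟩
    rw [← edgeMatrix_of_lt m hij, ← edgeMatrix_of_lt (squaredLengths p) hij,
      edgeMatrix_squaredLengths]
    cases j using Fin.cases with
    | zero => simp at hij
    | succ j =>
      cases i using Fin.cases with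
      | zero => simp [p_zero, p_succ, norm_sq]
      | succ i =>
        simp only [p_succ, dist_sq, ← norm_sq, ← gram_apply]
        ring

theorem mem_M_iff_det_gramMatrix_eq_zero {m : Edge (n + 2) → ℂ} :
    m ∈ M n (n + 2) ↔ (gramMatrix m).det = 0 :=
  mem_M_iff_exists_gram.trans (exists_gram_iff_det_eq_zero (isSymm_gramMatrix m))

end Gram

section OppositeSums

variable {R : Type*} [CommRing R]

/-- The sums and differences of the opposite edges `{01, 23}`, `{02, 13}`, `{03, 12}` of a
tetrahedron, the coordinates in which the equation of `L 2 4` is most symmetric. -/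
def oppositeSums (l : Edge 4 → R) : Fin 6 → R :=
  ![l ⟨(0, 1), by decide⟩ + l ⟨(2, 3), by decide⟩, l ⟨(0, 1), by decide⟩ - l ⟨(2, 3), by decide⟩,
    l ⟨(0, 2), by decide⟩ + l ⟨(1, 3), by decide⟩, l ⟨(0, 2), by decide⟩ - l ⟨(1, 3), by decide⟩,
    l ⟨(0, 3), by decide⟩ + l ⟨(1, 2), by decide⟩, l ⟨(0, 3), by decide⟩ - l ⟨(1, 2), by decide⟩]

/-- The equation of `L 2 4` in the coordinates `oppositeSums`, written in terms of the power sums of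
the squares `y i ^ 2` so as to exhibit its symmetries. -/
def sextic (y : Fin 6 → R) : R :=
  (∑ i, y i ^ 2) ^ 3 - 6 * (∑ i, y i ^ 2) * ∑ i, y i ^ 4 + 8 * ∑ i, y i ^ 6 - 48 * ∏ i, y i

theorem det_gramMatrix_squaring (l : Edge 4 → ℂ) :
    384 * (gramMatrix (squaring l)).det = - sextic (oppositeSums l) := by
  simp only [Matrix.det_fin_three, gramMatrix, Matrix.of_apply]
  simp only [Fin.succ_zero_eq_one, Fin.succ_one_eq_two, show (Fin.succ 2 : Fin 4) = 3 from rfl,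
    edgeMatrix_self, edgeMatrix_comm _ 2 1, edgeMatrix_comm _ 3 1, edgeMatrix_comm _ 3 2,
    edgeMatrix_of_lt _ (show (0 : Fin 4) < 1 by decide),
    edgeMatrix_of_lt _ (show (0 : Fin 4) < 2 by decide),
    edgeMatrix_of_lt _ (show (0 : Fin 4) < 3 by decide),
    edgeMatrix_of_lt _ (show (1 : Fin 4) < 2 by decide),
    edgeMatrix_of_lt _ (show (1 : Fin 4) < 3 by decide),
    edgeMatrix_of_lt _ (show (2 : Fin 4) < 3 by decide), squaring]
  simp only [sextic, oppositeSums, Fin.sum_univ_six, Fin.prod_univ_six, Matrix.cons_val]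
  ring

theorem mem_L_iff {l : Edge 4 → ℂ} : l ∈ L 2 4 ↔ sextic (oppositeSums l) = 0 := by
  have h := det_gramMatrix_squaring l
  rw [L, Set.mem_preimage, mem_M_iff_det_gramMatrix_eq_zero, ← neg_eq_zero (a := sextic _), ← h]
  simp

end OppositeSums

section Sextic

variable {R S : Type*} [CommRing R] [CommRing S]

theorem map_sextic (φ : R →+* S) (y : Fin 6 → R) : φ (sextic y) = sextic (φ ∘ y) := by
  simp [sextic, map_ofNat]

theorem sextic_smul (c : R) (y : Fin 6 → R) : sextic (c • y) = c ^ 6 * sextic y := by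
  simp only [sextic, Pi.smul_apply, smul_eq_mul, mul_pow, ← Finset.mul_sum, Fin.prod_univ_six]
  ring

theorem isHomogeneous_sextic {σ : Type*} {y : Fin 6 → MvPolynomial σ R}
    (hy : ∀ i, (y i).IsHomogeneous 1) : (sextic y).IsHomogeneous 6 := by
  have powerSum (k : ℕ) : (∑ i, y i ^ k).IsHomogeneous k :=
    .sum _ _ _ fun i _ => by simpa using (hy i).pow k
  have scalar (k : ℕ) [k.AtLeastTwo] :
      (OfNat.ofNat k : MvPolynomial σ R).IsHomogeneous 0 :=
    map_ofNat (MvPolynomial.C : R →+* MvPolynomial σ R) k ▸ MvPolynomial.isHomogeneous_C σ _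
  exact ((((powerSum 2).pow 3).sub (((scalar 6).mul (powerSum 2)).mul (powerSum 4))).add
    ((scalar 8).mul (powerSum 6))).sub
    ((scalar 48).mul (.prod Finset.univ y _ fun i _ => hy i))

theorem map_oppositeSums (φ : R →+* S) (l : Edge 4 → R) :
    φ ∘ oppositeSums l = oppositeSums (φ ∘ l) := by
  ext i
  fin_cases i <;> simp [oppositeSums]

/-- Twice the inverse of `oppositeSums`; the factor keeps it defined over any ring. -/
def edgesOfOppositeSums (y : Fin 6 → R) (e : Edge 4) : R :=
  !![0, y 0 + y 1, y 2 + y 3, y 4 + y 5;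
     0, 0, y 4 - y 5, y 2 - y 3;
     0, 0, 0, y 0 - y 1;
     0, 0, 0, 0] e.1.1 e.1.2

theorem oppositeSums_edgesOfOppositeSums (y : Fin 6 → R) :
    oppositeSums (edgesOfOppositeSums y) = (2 : R) • y := by
  ext i
  fin_cases i <;> simp [oppositeSums, edgesOfOppositeSums] <;> ring

theorem edgesOfOppositeSums_oppositeSums (l : Edge 4 → R) :
    edgesOfOppositeSums (oppositeSums l) = (2 : R) • l := by
  ext ⟨⟨i, j⟩, h⟩
  fin_cases i <;> fin_cases j <;>
    first
      | exact absurd h (by decide)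
      | simp [oppositeSums, edgesOfOppositeSums]; ring

end Sextic

section Irreducible

open MvPolynomial in
theorem natDegree_aeval_le_totalDegree {σ R A : Type*} [CommRing R] [CommRing A] [Algebra R A]
    {g : σ → Polynomial A} (hg : ∀ i, (g i).natDegree ≤ 1) (P : MvPolynomial σ R) :
    (aeval g P).natDegree ≤ P.totalDegree := by
  rw [aeval_def, eval₂_eq]
  refine Polynomial.natDegree_sum_le_of_forall_le _ _ fun d hd => ?_
  refine Polynomial.natDegree_mul_le.trans ?_
  rw [IsScalarTower.algebraMap_apply R A (Polynomial A), Polynomial.algebraMap_eq,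
    Polynomial.natDegree_C, zero_add]
  refine (Polynomial.natDegree_prod_le _ _).trans ((Finset.sum_le_sum fun i _ => ?_).trans
    (le_totalDegree hd))
  exact Polynomial.natDegree_pow_le.trans ((Nat.mul_le_mul_left _ (hg i)).trans (by simp))

open MvPolynomial in
theorem irreducible_of_irreducible_aeval {σ K A : Type*} [Field K] [CommRing A] [IsDomain A]
    [Algebra K A] {g : σ → Polynomial A} (hg : ∀ i, (g i).natDegree ≤ 1) {P : MvPolynomial σ K}
    (hP : Irreducible (aeval g P)) (hdeg : P.totalDegree ≤ (aeval g P).natDegree) :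
    Irreducible P := by
  have isUnit_left_factor : ∀ Q R, P = Q * R → IsUnit (aeval g Q) → IsUnit Q := by
    rintro Q R rfl hQ
    have hne : Q * R ≠ 0 := fun h => hP.ne_zero (by rw [h, map_zero])
    have h0 : (aeval g Q).natDegree = 0 := Polynomial.natDegree_eq_zero_of_isUnit hQ
    have hR := natDegree_aeval_le_totalDegree hg R
    rw [totalDegree_mul_of_isDomain (left_ne_zero_of_mul hne) (right_ne_zero_of_mul hne),
      map_mul] at hdeg
    have := Polynomial.natDegree_mul_le (p := aeval g Q) (q := aeval g R)
    obtain ⟨c, rfl⟩ : ∃ c, Q = C c := ⟨_, totalDegree_eq_zero_iff_eq_C.1 (by lia)⟩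
    refine (IsUnit.mk0 c fun hc => hne ?_).map C
    simp [hc]
  refine ⟨fun h => hP.not_isUnit (h.map _), fun Q R hQR => ?_⟩
  rcases hP.isUnit_or_isUnit (by rw [hQR, map_mul]) with h | h
  · exact Or.inl (isUnit_left_factor Q R hQR h)
  · exact Or.inr (isUnit_left_factor R Q (by rw [hQR, mul_comm]) h)

open Polynomial

/-- A plane in the coordinates `oppositeSums`, parametrized by two variables, on which the sextic is
an Eisenstein polynomial when `ζ ^ 4 = -1`. The constants are chosen so that the middle four
coordinates have power sums `-1` of orders `2`, `4`, `6` and product `0`. -/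
noncomputable def slice (ζ : ℂ) : Fin 6 → ℂ[X][X] :=
  ![C X, C (C (ζ ^ 2)), C (C ζ), C (C (ζ ^ 3)), 0, X]

theorem natDegree_edgesOfOppositeSums_le {A : Type*} [CommRing A] {y : Fin 6 → A[X]} {n : ℕ}
    (hy : ∀ i, (y i).natDegree ≤ n) (e : Edge 4) : (edgesOfOppositeSums y e).natDegree ≤ n := by
  obtain ⟨⟨i, j⟩, h⟩ := e
  fin_cases i <;> fin_cases j <;>
    first
      | exact absurd h (by decide)
      | exact (natDegree_add_le _ _).trans (max_le (hy _) (hy _))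
      | exact (natDegree_sub_le _ _).trans (max_le (hy _) (hy _))

theorem natDegree_slice_le (ζ : ℂ) (i : Fin 6) : (slice ζ i).natDegree ≤ 1 := by
  fin_cases i
  exacts [(natDegree_C _).trans_le zero_le_one, (natDegree_C _).trans_le zero_le_one,
    (natDegree_C _).trans_le zero_le_one, (natDegree_C _).trans_le zero_le_one,
    natDegree_zero.trans_le zero_le_one, natDegree_X_le]

/-- The sextic on `slice ζ` is `3 * (X ^ 6 - (Y ^ 2 - 1) * sliceTail)`, where `Y` is the variable of
the coefficient ring. -/
noncomputable def sliceTail : ℂ[X][X] :=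
  X ^ 4 + C (X ^ 2 + 3) * X ^ 2 - C (X ^ 4 + 2 * X ^ 2 + 5)

theorem sextic_slice {ζ : ℂ} (hζ : ζ ^ 4 = -1) :
    sextic (slice ζ) = 3 * (X ^ 6 - C (X ^ 2 - 1) * sliceTail) := by
  have hz : (C (C ζ) : ℂ[X][X]) ^ 4 = -1 := by simp only [← map_pow, hζ, map_neg, map_one]
  have sum_sq : ∑ i, slice ζ i ^ 2 = C X ^ 2 - 1 + X ^ 2 := by
    simp only [slice, Fin.sum_univ_six, Matrix.cons_val, map_pow]
    linear_combination (1 + C (C ζ) ^ 2) * hz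
  have sum_pow_four : ∑ i, slice ζ i ^ 4 = C X ^ 4 - 1 + X ^ 4 := by
    simp only [slice, Fin.sum_univ_six, Matrix.cons_val, map_pow]
    linear_combination (C (C ζ) ^ 8 + 1) * hz
  have sum_pow_six : ∑ i, slice ζ i ^ 6 = C X ^ 6 - 1 + X ^ 6 := by
    simp only [slice, Fin.sum_univ_six, Matrix.cons_val, map_pow]
    linear_combination (1 + C (C ζ) ^ 6) * (C (C ζ) ^ 8 - C (C ζ) ^ 4 + 1) * hz
  have prod_eq_zero : ∏ i, slice ζ i = 0 := Finset.prod_eq_zero (Finset.mem_univ 4) rfl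
  rw [sextic, sum_sq, sum_pow_four, sum_pow_six, prod_eq_zero, sliceTail]
  simp only [map_pow, map_add, map_sub, map_mul, map_ofNat, map_one]
  ring

theorem natDegree_mul_sliceTail_lt : (C (X ^ 2 - 1) * sliceTail).natDegree < 6 := by
  unfold sliceTail
  refine lt_of_le_of_lt (b := 4) ?_ (by norm_num)
  compute_degree

theorem natDegree_slicePoly : (X ^ 6 - C (X ^ 2 - 1) * sliceTail).natDegree = 6 := by
  rw [natDegree_sub_eq_left_of_natDegree_lt, natDegree_X_pow]
  rw [natDegree_X_pow]
  exact natDegree_mul_sliceTail_lt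

theorem irreducible_slicePoly : Irreducible (X ^ 6 - C (X ^ 2 - 1) * sliceTail) := by
  have factor : (X ^ 2 - 1 : ℂ[X]) = (X - C 1) * (X + 1) := by
    rw [C_1]
    ring
  have monic : (X ^ 6 - C (X ^ 2 - 1) * sliceTail).Monic :=
    monic_X_pow_sub (degree_le_natDegree.trans_lt (Nat.cast_lt.2 natDegree_mul_sliceTail_lt))
  have prime : (Ideal.span {(X - C 1 : ℂ[X])}).IsPrime :=
    (Ideal.span_singleton_prime (X_sub_C_ne_zero 1)).2 (prime_X_sub_C 1)
  refine IsEisensteinAt.irreducible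
    (monic.isEisensteinAt_of_mem_of_notMem prime.ne_top (fun {n} hn => ?_) ?_) prime
    monic.isPrimitive (by rw [natDegree_slicePoly]; norm_num)
  · rw [natDegree_slicePoly] at hn
    rw [coeff_sub, coeff_X_pow, if_neg hn.ne, zero_sub, coeff_C_mul, Ideal.mem_span_singleton,
      factor, mul_assoc, dvd_neg]
    exact dvd_mul_right _ _
  · rw [Ideal.span_singleton_pow, Ideal.mem_span_singleton, coeff_sub, coeff_C_mul, coeff_X_pow,
      if_neg (by norm_num), zero_sub, dvd_neg, factor, mul_assoc, pow_two,
      mul_dvd_mul_iff_left (X_sub_C_ne_zero 1), dvd_iff_isRoot]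
    norm_num [sliceTail, coeff_zero_eq_eval_zero]

/-- The polynomial in the edge lengths whose zero locus is `L 2 4`. -/
noncomputable def equation : MvPolynomial (Edge 4) ℂ :=
  sextic (oppositeSums MvPolynomial.X)

theorem aeval_equation {A : Type*} [CommRing A] [Algebra ℂ A] (l : Edge 4 → A) :
    MvPolynomial.aeval l equation = sextic (oppositeSums l) := by
  rw [equation, ← RingHom.coe_coe, map_sextic, map_oppositeSums]
  congr! 2
  ext e
  simp

theorem isHomogeneous_equation : equation.IsHomogeneous 6 := by
  refine isHomogeneous_sextic fun i => ?_
  have hX := MvPolynomial.isHomogeneous_X ℂ (σ := Edge 4)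
  fin_cases i
  exacts [(hX _).add (hX _), (hX _).sub (hX _), (hX _).add (hX _), (hX _).sub (hX _),
    (hX _).add (hX _), (hX _).sub (hX _)]

theorem irreducible_equation : Irreducible equation := by
  obtain ⟨ζ, hζ⟩ := IsAlgClosed.exists_pow_nat_eq (-1 : ℂ) four_pos
  have hslice : MvPolynomial.aeval (edgesOfOppositeSums (slice ζ)) equation =
      C (C 192) * (X ^ 6 - C (X ^ 2 - 1) * sliceTail) := by
    rw [aeval_equation, oppositeSums_edgesOfOppositeSums, sextic_smul, sextic_slice hζ]
    simp only [map_ofNat]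
    ring
  have hunit : IsUnit (C (C 192) : ℂ[X][X]) :=
    ((IsUnit.mk0 (192 : ℂ) (by norm_num)).map C).map C
  refine irreducible_of_irreducible_aeval
    (natDegree_edgesOfOppositeSums_le (natDegree_slice_le ζ)) ?_ ?_
  · rw [hslice]
    exact (irreducible_isUnit_mul hunit).2 irreducible_slicePoly
  · rw [hslice, natDegree_mul hunit.ne_zero irreducible_slicePoly.ne_zero, natDegree_C, zero_add,
      natDegree_slicePoly]
    exact isHomogeneous_equation.totalDegree_le

end Irreducible

section Hypersurface

open MvPolynomial

variable {σ : Type}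

theorem isIrreducibleVariety_of_isPrime [Finite σ] (P : Ideal (MvPolynomial σ ℂ)) [hP : P.IsPrime] :
    IsIrreducibleVariety (zeroLocus ℂ P) := by
  refine ⟨⟨P, rfl⟩, ?_, ?_⟩
  · by_contra h
    have := IsPrime.vanishingIdeal_zeroLocus (K := ℂ) P
    rw [Set.not_nonempty_iff_eq_empty.1 h, vanishingIdeal_empty] at this
    exact hP.ne_top this.symm
  · rintro _ _ ⟨I, rfl⟩ ⟨J, rfl⟩ h
    have hIJ : I * J ≤ P := by
      rw [← IsPrime.vanishingIdeal_zeroLocus (K := ℂ) P, h]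
      refine Ideal.mul_le.2 fun f hf g hg x hx => ?_
      rw [map_mul]
      rcases hx with hx | hx
      · rw [hx f hf, zero_mul]
      · rw [hx g hg, mul_zero]
    rcases hP.mul_le.1 hIJ with hI | hJ
    · exact Or.inl ((zeroLocus_anti_mono hI).antisymm (by rw [h]; exact Set.subset_union_left))
    · exact Or.inr ((zeroLocus_anti_mono hJ).antisymm (by rw [h]; exact Set.subset_union_right))

theorem components_of_isIrreducibleVariety {V : Set (σ → ℂ)} (hV : IsIrreducibleVariety V) :
    components V = {V} := by
  ext Z
  constructor
  · intro hZ
    exact hZ.1.2.antisymm (hZ.2 ⟨hV, subset_rfl⟩ hZ.1.2)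
  · rintro rfl
    exact ⟨⟨hV, subset_rfl⟩, fun Y hY _ => hY.2⟩

theorem localDimension_of_isIrreducibleVariety {V : Set (σ → ℂ)} (hV : IsIrreducibleVariety V)
    {x : σ → ℂ} (hx : x ∈ V) : localDimension V x = dimension V := by
  have : {Z | Z ∈ components V ∧ x ∈ Z} = {V} := by
    ext Z
    rw [components_of_isIrreducibleVariety hV]
    simp only [Set.mem_ofPred_eq, Set.mem_singleton_iff, and_iff_left_iff_imp]
    rintro rfl
    exact hx
  rw [localDimension, this, iSup_singleton]

/-- The automorphism of the polynomial ring induced by a translation. -/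
noncomputable def translate (c : σ → ℂ) : MvPolynomial σ ℂ ≃ₐ[ℂ] MvPolynomial σ ℂ :=
  AlgEquiv.ofAlgHom (aeval fun i => X i + C (c i)) (aeval fun i => X i - C (c i))
    (by ext i; simp [algebraMap_eq]) (by ext i; simp [algebraMap_eq])

theorem height_vanishingIdeal_singleton [Finite σ] (x y : σ → ℂ) :
    (vanishingIdeal ℂ {x} : Ideal (MvPolynomial σ ℂ)).height =
      (vanishingIdeal ℂ {y} : Ideal (MvPolynomial σ ℂ)).height := by
  rw [← RingEquiv.height_comap (translate (y - x)).toRingEquiv]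
  congr 1
  ext f
  simp only [Ideal.mem_comap, mem_vanishingIdeal_singleton_iff]
  change aeval x (aeval (fun i => X i + C ((y - x) i)) f) = 0 ↔ _
  rw [← AlgHom.comp_apply, comp_aeval]
  simp

theorem natCard_le_height_vanishingIdeal_singleton [Finite σ] (x : σ → ℂ) :
    (Nat.card σ : WithBot ℕ∞) ≤ (vanishingIdeal ℂ {x} : Ideal (MvPolynomial σ ℂ)).height := by
  have h := MvPolynomial.ringKrullDim_of_isNoetherianRing (R := ℂ) (ι := σ)
  rw [ringKrullDim_eq_zero_of_field, zero_add, ← Ideal.sup_isMaximal_height_eq_ringKrullDim] at h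
  rw [← h, WithBot.coe_le_coe]
  refine iSup₂_le fun I hI => ?_
  obtain ⟨y, rfl⟩ := (isMaximal_iff_eq_vanishingIdeal_singleton).1 hI
  exact (height_vanishingIdeal_singleton y x).le

theorem ringKrullDim_quotient_span_singleton [Finite σ] {f : MvPolynomial σ ℂ} (hf : f ≠ 0)
    {x : σ → ℂ} (hx : aeval x f = 0) {n : ℕ} (hn : Nat.card σ = n + 1) :
    ringKrullDim (MvPolynomial σ ℂ ⧸ Ideal.span {f}) = n := by
  have dim_add_one_le :=
    ringKrullDim_quotient_succ_le_of_nonZeroDivisor (mem_nonZeroDivisors_of_ne_zero hf)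
  have le_dim_add_one := (natCard_le_height_vanishingIdeal_singleton x).trans
    (Ideal.height_le_ringKrullDim_quotient_add_one
      ((mem_vanishingIdeal_singleton_iff (k := ℂ) x f).2 hx))
  rw [MvPolynomial.ringKrullDim_of_isNoetherianRing, ringKrullDim_eq_zero_of_field, zero_add,
    hn] at dim_add_one_le
  rw [hn] at le_dim_add_one
  have dim_add_one := dim_add_one_le.antisymm le_dim_add_one
  generalize ringKrullDim (MvPolynomial σ ℂ ⧸ Ideal.span {f}) = d at dim_add_one
  cases d with
  | bot => exact absurd dim_add_one (WithBot.bot_ne_coe (a := ((n + 1 : ℕ) : ℕ∞)))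
  | coe a =>
    have : a + 1 = (n : ℕ∞) + 1 := by exact_mod_cast dim_add_one
    exact congrArg _ (ENat.add_left_injective_of_ne_top ENat.one_ne_top this)

variable [Fintype σ]

theorem mem_tangentSpace_iff_of_vanishingIdeal_eq {V : Set (σ → ℂ)} {f : MvPolynomial σ ℂ}
    (hV : vanishingIdeal ℂ V = Ideal.span {f}) {x : σ → ℂ} (hx : x ∈ V) {v : σ → ℂ} :
    v ∈ tangentSpace V x ↔ ∑ i, eval x (pderiv i f) * v i = 0 := by
  have hf : f ∈ vanishingIdeal ℂ V := hV ▸ Ideal.mem_span_singleton_self f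
  have hfx : eval x f = 0 := hf x hx
  refine ⟨fun h => h f hf, fun h g hg => ?_⟩
  rw [hV, Ideal.mem_span_singleton'] at hg
  obtain ⟨a, rfl⟩ := hg
  simp only [Derivation.leibniz, smul_eq_mul, map_add, map_mul, hfx, zero_mul, add_zero,
    mul_assoc, ← Finset.mul_sum, h, mul_zero]

theorem finrank_tangentSpace_ne_iff {V : Set (σ → ℂ)} {f : MvPolynomial σ ℂ}
    (hV : vanishingIdeal ℂ V = Ideal.span {f}) {x : σ → ℂ} (hx : x ∈ V) {n : ℕ}
    (hn : Nat.card σ = n + 1) :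
    Module.finrank ℂ (tangentSpace V x) ≠ n ↔ ∀ i, eval x (pderiv i f) = 0 := by
  classical
  let φ : (σ → ℂ) →ₗ[ℂ] ℂ := ∑ i, eval x (pderiv i f) • LinearMap.proj i
  have hφ : tangentSpace V x = LinearMap.ker φ := by
    ext v
    rw [mem_tangentSpace_iff_of_vanishingIdeal_eq hV hx]
    simp [φ]
  have rank_nullity := φ.finrank_range_add_finrank_ker
  rw [Module.finrank_fintype_fun_eq_card, ← Nat.card_eq_fintype_card, hn] at rank_nullity
  have φ_eq_zero_iff : φ = 0 ↔ ∀ i, eval x (pderiv i f) = 0 := by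
    constructor
    · intro h i
      have := LinearMap.congr_fun h (Pi.single i 1)
      simpa [φ, Pi.single_apply] using this
    · intro h
      simp [φ, h]
  rw [hφ, ← φ_eq_zero_iff]
  rcases eq_or_ne φ 0 with h | h
  · rw [h, LinearMap.range_zero, finrank_bot, zero_add] at rank_nullity
    rw [h, rank_nullity]
    simp
  · rw [LinearMap.range_eq_top.2 (LinearMap.surjective h), finrank_top,
      Module.finrank_self] at rank_nullity
    simp only [h, iff_false, not_not]
    omega

theorem mem_singularLocus_iff_of_irreducible {V : Set (σ → ℂ)} {f : MvPolynomial σ ℂ}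
    (hf : Irreducible f) (hV : V = zeroLocus ℂ (Ideal.span {f})) {x : σ → ℂ} :
    x ∈ singularLocus V ↔ x ∈ V ∧ ∀ i, eval x (pderiv i f) = 0 := by
  have hprime : (Ideal.span {f}).IsPrime :=
    (Ideal.span_singleton_prime hf.ne_zero).2 hf.prime
  have hI : vanishingIdeal ℂ V = Ideal.span {f} := by
    rw [hV, IsPrime.vanishingIdeal_zeroLocus]
  have hirr : IsIrreducibleVariety V := hV ▸ isIrreducibleVariety_of_isPrime _
  refine and_congr_right fun hx => ?_
  have hfx : aeval x f = 0 := by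
    rw [hV] at hx
    exact hx f (Ideal.mem_span_singleton_self f)
  obtain ⟨n, hn⟩ : ∃ n, Nat.card σ = n + 1 := by
    refine Nat.exists_eq_succ_of_ne_zero fun h => ?_
    have : IsEmpty σ := Finite.card_eq_zero_iff.1 h
    apply hf.ne_zero
    rw [eq_C_of_isEmpty f] at hfx ⊢
    simpa using hfx
  rw [localDimension_of_isIrreducibleVariety hirr hx, dimension, hI,
    ringKrullDim_quotient_span_singleton hf.ne_zero hfx hn, ← finrank_tangentSpace_ne_iff hI hx hn]
  norm_cast

end Hypersurface

section Gradient

variable {R : Type*} [CommRing R]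

/-- The partial derivatives of `sextic`. -/
def sexticGradient (y : Fin 6 → R) (i : Fin 6) : R :=
  6 * (8 * y i ^ 5 - 4 * (∑ j, y j ^ 2) * y i ^ 3
    + ((∑ j, y j ^ 2) ^ 2 - 2 * ∑ j, y j ^ 4) * y i - 8 * ∏ j ∈ Finset.univ.erase i, y j)

theorem map_sexticGradient {S : Type*} [CommRing S] (φ : R →+* S) (y : Fin 6 → R) (i : Fin 6) :
    φ (sexticGradient y i) = sexticGradient (φ ∘ y) i := by
  simp [sexticGradient, map_ofNat]

theorem derivation_prod {A M ι : Type*} [CommRing A] [Algebra A R] [AddCommGroup M] [Module R M]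
    [Module A M] [DecidableEq ι] (D : Derivation A R M) (s : Finset ι) (f : ι → R) :
    D (∏ i ∈ s, f i) = ∑ i ∈ s, (∏ j ∈ s.erase i, f j) • D (f i) := by
  induction s using Finset.induction_on with
  | empty => simp
  | insert a s ha ih =>
    rw [Finset.prod_insert ha, D.leibniz, ih, Finset.sum_insert ha, Finset.erase_insert ha,
      Finset.smul_sum, add_comm]
    congr 1
    refine Finset.sum_congr rfl fun i hi => ?_
    rw [Finset.erase_insert_of_ne (ne_of_mem_of_not_mem hi ha).symm,
      Finset.prod_insert (fun h => ha (Finset.mem_of_mem_erase h)), smul_smul]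

theorem derivation_sextic {A M : Type*} [CommRing A] [Algebra A R] [AddCommGroup M] [Module R M]
    [Module A M] (D : Derivation A R M) (y : Fin 6 → R) :
    D (sextic y) = ∑ i, sexticGradient y i • D (y i) := by
  have powerSum (k : ℕ) : D (∑ i, y i ^ k) = k • ∑ i, y i ^ (k - 1) • D (y i) := by
    simp [Derivation.leibniz_pow, Finset.smul_sum]
  rw [sextic]
  have scalar (n : ℕ) [n.AtLeastTwo] (a : R) :
      D (OfNat.ofNat n * a) = (OfNat.ofNat n : R) • D a := by
    have : D (OfNat.ofNat n) = 0 := D.map_natCast n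
    rw [D.leibniz, this, smul_zero, add_zero]
  simp only [map_sub, map_add, mul_assoc, scalar, D.leibniz, D.leibniz_pow, powerSum,
    derivation_prod, sexticGradient, Finset.smul_sum, ← Finset.sum_add_distrib,
    ← Finset.sum_sub_distrib]
  refine Finset.sum_congr rfl fun i _ => ?_
  simp only [smul_add, smul_smul]
  module

theorem mul_sexticGradient (y : Fin 6 → R) (i : Fin 6) :
    y i * sexticGradient y i = 6 * (8 * (y i ^ 2) ^ 3 - 4 * (∑ j, y j ^ 2) * (y i ^ 2) ^ 2
      + ((∑ j, y j ^ 2) ^ 2 - 2 * ∑ j, y j ^ 4) * y i ^ 2 - 8 * ∏ j, y j) := by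
  rw [← Finset.mul_prod_erase _ _ (Finset.mem_univ i), sexticGradient]
  ring

theorem sum_mul_sexticGradient (y : Fin 6 → R) : ∑ i, y i * sexticGradient y i = 6 * sextic y := by
  simp only [mul_sexticGradient, ← pow_mul, ← Finset.mul_sum, Finset.sum_add_distrib,
    Finset.sum_sub_distrib, Finset.sum_const, Finset.card_univ, Fintype.card_fin, sextic,
    nsmul_eq_mul]
  push_cast
  ring

theorem oppositeSums_smul (c : R) (l : Edge 4 → R) :
    oppositeSums (c • l) = c • oppositeSums l := by
  ext i
  fin_cases i <;> simp [oppositeSums, mul_add, mul_sub]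

/-- The change of coordinates `oppositeSums`, as a linear equivalence. -/
noncomputable def oppositeSumsEquiv : (Edge 4 → ℂ) ≃ₗ[ℂ] (Fin 6 → ℂ) where
  toFun := oppositeSums
  map_add' l m := by
    ext i
    fin_cases i <;> simp [oppositeSums] <;> ring
  map_smul' := oppositeSums_smul
  invFun y := (2⁻¹ : ℂ) • edgesOfOppositeSums y
  left_inv l := by
    simp only [edgesOfOppositeSums_oppositeSums, inv_smul_smul₀ (two_ne_zero (α := ℂ))]
  right_inv y := by
    rw [oppositeSums_smul, oppositeSums_edgesOfOppositeSums, inv_smul_smul₀ two_ne_zero]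

theorem eval_pderiv_equation (l : Edge 4 → ℂ) (e : Edge 4) :
    MvPolynomial.eval l (MvPolynomial.pderiv e equation) =
      edgesOfOppositeSums (sexticGradient (oppositeSums l)) e := by
  have evalX : MvPolynomial.eval l ∘ MvPolynomial.X = l := funext fun _ => MvPolynomial.eval_X _
  have gradient (i : Fin 6) : MvPolynomial.eval l (sexticGradient (oppositeSums MvPolynomial.X) i) =
      sexticGradient (oppositeSums l) i := by
    rw [map_sexticGradient, map_oppositeSums, evalX]
  rw [equation, derivation_sextic, map_sum]
  simp only [smul_eq_mul, map_mul, gradient, Fin.sum_univ_six]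
  generalize sexticGradient (oppositeSums l) = g
  obtain ⟨⟨i, j⟩, h⟩ := e
  fin_cases i <;> fin_cases j <;>
    first
      | exact absurd h (by decide)
      | simp [oppositeSums, edgesOfOppositeSums, MvPolynomial.pderiv_X, ← sub_eq_add_neg]

theorem mem_singularLocus_iff {l : Edge 4 → ℂ} :
    l ∈ singularLocus (L 2 4) ↔ sexticGradient (oppositeSums l) = 0 := by
  have hL : L 2 4 = MvPolynomial.zeroLocus ℂ (Ideal.span {equation}) := by
    ext l
    rw [mem_L_iff, MvPolynomial.zeroLocus_span, ← aeval_equation]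
    simp
  have hgrad : (∀ e, MvPolynomial.eval l (MvPolynomial.pderiv e equation) = 0) ↔
      sexticGradient (oppositeSums l) = 0 := by
    simp only [eval_pderiv_equation]
    rw [← oppositeSumsEquiv.symm.map_eq_zero_iff]
    exact funext_iff.symm.trans (smul_eq_zero_iff_right (inv_ne_zero (two_ne_zero (α := ℂ)))).symm
  rw [mem_singularLocus_iff_of_irreducible irreducible_equation hL, hgrad, mem_L_iff,
    and_iff_right_iff_imp]
  intro h
  have := sum_mul_sexticGradient (oppositeSums l)
  simpa [h] using this.symm

end Gradient

section PowerSums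

variable {ι K : Type*} [Fintype ι] [Field K]

theorem sum_eval_eq_of_sum_pow_eq {f g : ι → K} {n : ℕ}
    (h : ∀ k < n, ∑ i, f i ^ k = ∑ i, g i ^ k) {p : Polynomial K} (hp : p.natDegree < n) :
    ∑ i, p.eval (f i) = ∑ i, p.eval (g i) := by
  simp only [Polynomial.eval_eq_sum_range' hp]
  rw [Finset.sum_comm, Finset.sum_comm (s := Finset.univ)]
  exact Finset.sum_congr rfl fun k hk => by
    rw [← Finset.mul_sum, ← Finset.mul_sum, h k (Finset.mem_range.1 hk)]

theorem exists_perm_comp_eq_of_sum_pow_eq [CharZero K] {f g : ι → K} (s : Finset K)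
    (hf : ∀ i, f i ∈ s) (hg : ∀ i, g i ∈ s)
    (h : ∀ k < s.card, ∑ i, f i ^ k = ∑ i, g i ^ k) :
    ∃ τ : Equiv.Perm ι, f ∘ τ = g := by
  classical
  -- The sum of the Lagrange basis polynomial at `c` counts the indices with value `c`.
  have sum_basis (c : K) (hc : c ∈ s) (u : ι → K) (hu : ∀ i, u i ∈ s) :
      ∑ i, (Lagrange.basis s id c).eval (u i) = Fintype.card {i // u i = c} := by
    have (i : ι) : (Lagrange.basis s id c).eval (u i) = if u i = c then 1 else 0 := by
      split_ifs with hi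
      · rw [hi]
        exact Lagrange.eval_basis_self Function.injective_id.injOn hc
      · exact Lagrange.eval_basis_of_ne (v := id) (Ne.symm hi) (hu i)
    simp only [this, Finset.sum_boole, Fintype.card_subtype]
  have fiber (c : K) : Nonempty ({i // g i = c} ≃ {i // f i = c}) := by
    rw [← Fintype.card_eq]
    by_cases hc : c ∈ s
    · have hdeg : (Lagrange.basis s id c).natDegree < s.card := by
        rw [Lagrange.natDegree_basis Function.injective_id.injOn hc]
        exact Nat.sub_lt (Finset.card_pos.2 ⟨c, hc⟩) one_pos
      have := sum_eval_eq_of_sum_pow_eq h hdeg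
      rw [sum_basis c hc f hf, sum_basis c hc g hg] at this
      exact_mod_cast this.symm
    · have (u : ι → K) (hu : ∀ i, u i ∈ s) : IsEmpty {i // u i = c} :=
        ⟨fun i => hc (i.2 ▸ hu i)⟩
      have hf := this f hf
      have hg := this g hg
      simp only [Fintype.card_eq_zero]
  exact ⟨Equiv.ofFiberEquiv fun c => (fiber c).some,
    funext fun i => Equiv.ofFiberEquiv_map (fun c => (fiber c).some) i⟩

end PowerSums

section Signs

variable {ι R : Type*} [Fintype ι] [CommRing R] [IsDomain R] [CharZero R]

theorem exists_signs_prod_eq_one {a b : ι → R} (h : ∀ i, b i ^ 2 = a i ^ 2)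
    (hprod : ∏ i, b i = ∏ i, a i) :
    ∃ s : ι → ℤˣ, ∏ i, s i = 1 ∧ ∀ i, b i = (s i : ℤ) * a i := by
  classical
  have (i : ι) : ∃ s : ℤˣ, b i = (s : ℤ) * a i := by
    rcases sq_eq_sq_iff_eq_or_eq_neg.1 (h i) with h | h
    · exact ⟨1, by simp [h]⟩
    · exact ⟨-1, by simp [h]⟩
  choose s hs using this
  rcases Int.units_eq_one_or (∏ i, s i) with hs1 | hs1
  · exact ⟨s, hs1, hs⟩
  have hneg : ∏ i, a i = -∏ i, a i := by
    have : ∏ i, ((s i : ℤ) : R) = -1 := by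
      rw [← Int.cast_prod, ← Units.coe_prod, hs1]
      simp
    calc ∏ i, a i = ∏ i, (s i : ℤ) * a i := by rw [← hprod, Fintype.prod_congr _ _ hs]
      _ = -∏ i, a i := by rw [Finset.prod_mul_distrib, this, neg_one_mul]
  obtain ⟨i, -, hi⟩ := Finset.prod_eq_zero_iff.1 (self_eq_neg.1 hneg)
  refine ⟨Function.update s i (-s i), ?_, fun j => ?_⟩
  · rw [Finset.prod_update_of_mem (Finset.mem_univ i), neg_mul, ← Finset.erase_eq,
      Finset.mul_prod_erase _ _ (Finset.mem_univ i), hs1, neg_neg]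
  · rcases eq_or_ne j i with rfl | hj
    · rw [hs, hi]
      simp
    · rw [Function.update_of_ne hj, hs]

end Signs

section Pairings

/-- The standard perfect matching `{0, 1}, {2, 3}, {4, 5}` of six points, as the map to the set of
its three pairs. -/
def pairIndex : Fin 6 → Fin 3 := ![0, 0, 1, 1, 2, 2]

/-- The six coordinates agree in pairs up to sign, with an even number of minus signs. To avoid
choosing signs, the pairs are described by their common squares `r`, and the parity of the number
of minus signs by the product. -/
def IsSignedPairing (y : Fin 6 → ℂ) : Prop :=
  ∃ (τ : Equiv.Perm (Fin 6)) (r : Fin 3 → ℂ),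
    (∀ k, y (τ k) ^ 2 = r (pairIndex k)) ∧ ∏ k, y k = ∏ m, r m

theorem sum_comp_pairIndex {M : Type*} [AddCommMonoid M] (f : Fin 3 → M) :
    ∑ k, f (pairIndex k) = 2 • ∑ m, f m := by
  simp only [pairIndex, Fin.sum_univ_six, Fin.sum_univ_three, Matrix.cons_val]
  abel

theorem IsSignedPairing.sexticGradient_eq_zero {y : Fin 6 → ℂ} (hy : IsSignedPairing y) :
    sexticGradient y = 0 := by
  obtain ⟨τ, r, hr, hprod⟩ := hy
  have sum_sq : ∑ j, y j ^ 2 = 2 * ∑ m, r m := by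
    rw [← Equiv.sum_comp τ, Fintype.sum_congr _ _ hr, sum_comp_pairIndex r, nsmul_eq_mul,
      Nat.cast_ofNat]
  have sum_fourth : ∑ j, y j ^ 4 = 2 * ∑ m, r m ^ 2 := by
    have (k : Fin 6) : y (τ k) ^ 4 = r (pairIndex k) ^ 2 := by rw [← hr, ← pow_mul]
    rw [← Equiv.sum_comp τ, Fintype.sum_congr _ _ this, sum_comp_pairIndex (fun m => r m ^ 2),
      nsmul_eq_mul, Nat.cast_ofNat]
  funext i
  obtain ⟨k, rfl⟩ := τ.surjective i
  rcases eq_or_ne (y (τ k)) 0 with hzero | hne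
  · have partner : ∀ k, ∃ k', k' ≠ k ∧ pairIndex k' = pairIndex k := by decide
    obtain ⟨k', hk', hkk'⟩ := partner k
    have hzero' : y (τ k') = 0 := by
      rw [← sq_eq_zero_iff, hr, hkk', ← hr, hzero, zero_pow two_ne_zero]
    have := Finset.prod_eq_zero
      (Finset.mem_erase.2 ⟨τ.injective.ne hk', Finset.mem_univ _⟩) hzero'
    simp [sexticGradient, hzero, this]
  · refine (mul_eq_zero.1 ?_).resolve_left hne
    rw [mul_sexticGradient, hr, sum_sq, sum_fourth, hprod]
    generalize pairIndex k = m
    simp only [Fin.sum_univ_three, Fin.prod_univ_three]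
    fin_cases m <;> simp only [Fin.zero_eta, Fin.mk_one, Fin.reduceFinMk] <;> ring

theorem isSignedPairing_of_sexticGradient_eq_zero {y : Fin 6 → ℂ} (hy : sexticGradient y = 0) :
    IsSignedPairing y := by
  classical
  let P : Cubic ℂ := ⟨8, -4 * ∑ j, y j ^ 2, (∑ j, y j ^ 2) ^ 2 - 2 * ∑ j, y j ^ 4, -8 * ∏ j, y j⟩
  have ha : P.a ≠ 0 := by simp [P]
  obtain ⟨r₀, r₁, r₂, hroots⟩ := (Cubic.splits_iff_roots_eq_three (φ := RingHom.id ℂ) ha).1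
    (IsAlgClosed.splits _)
  have hb := Cubic.b_eq_three_roots ha hroots
  have hc := Cubic.c_eq_three_roots ha hroots
  have hd := Cubic.d_eq_three_roots ha hroots
  simp only [P, RingHom.id_apply] at hb hc hd
  let r : Fin 3 → ℂ := ![r₀, r₁, r₂]
  have mem_roots (i : Fin 6) : y i ^ 2 ∈ Finset.univ.image r := by
    have := mul_sexticGradient y i
    rw [hy, Pi.zero_apply, mul_zero] at this
    have : (y i ^ 2 - r₀) * (y i ^ 2 - r₁) * (y i ^ 2 - r₂) = 0 := by
      linear_combination (-1 / 48) * this - (1/8) * (y i ^ 2) ^ 2 * hb - (1/8) * y i ^ 2 * hc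
        - (1/8) * hd
    simpa [r, Fin.exists_fin_succ, sub_eq_zero, or_assoc, eq_comm (b := y i ^ 2)] using this
  obtain ⟨τ, hτ⟩ := exists_perm_comp_eq_of_sum_pow_eq (f := fun i => y i ^ 2)
    (g := r ∘ pairIndex) (Finset.univ.image r) mem_roots (fun i => by simp) fun k hk => by
      have : k < 3 := hk.trans_le Finset.card_image_le
      simp only [Function.comp_apply, sum_comp_pairIndex fun m => r m ^ k]
      simp only [Fin.sum_univ_three, r, Matrix.cons_val, ← pow_mul, nsmul_eq_mul, Nat.cast_ofNat]
      interval_cases k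
      · norm_num
      · simp only [mul_one, pow_one]
        linear_combination (-1/4) * hb
      · simp only [Nat.reduceMul]
        linear_combination (-1/2) * hc - (1/8) * (∑ j, y j ^ 2 + 2 * (r₀ + r₁ + r₂)) * hb
  refine ⟨τ, r, congrFun hτ, ?_⟩
  simp only [Fin.prod_univ_three, r, Matrix.cons_val]
  linear_combination (-1/8) * hd

end Pairings

section Planes

/-- The perfect matching `{0, τ 1}, {τ 2, τ 3}, {τ 4, τ 5}` of six points, where `τ 1` is one of the
five partners of `0` and `τ 3` one of the three remaining partners of `τ 2`. -/
def matching (i : Fin 5) (j : Fin 3) : Equiv.Perm (Fin 6) :=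
  Equiv.swap 1 i.succ * Equiv.swap 3 (Fin.natAdd 3 j)

theorem exists_matching (τ : Equiv.Perm (Fin 6)) : ∃ i j, ∃ σ : Equiv.Perm (Fin 3),
    ∀ k, pairIndex (τ.symm (matching i j k)) = σ (pairIndex k) := by
  revert τ
  decide +kernel

theorem matching_unique {i i' : Fin 5} {j j' : Fin 3}
    (h : ∀ k l, pairIndex k = pairIndex l → pairIndex ((matching i j).symm (matching i' j' k)) =
      pairIndex ((matching i j).symm (matching i' j' l))) : i = i' ∧ j = j' := by
  revert i i' j j'
  decide +kernel

/-- Signs on the pairs of `pairIndex`: the first coordinates of the pairs have sign `1`, and the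
signs of the second ones have product `1`. -/
def pairSigns (δ ε : ℤˣ) : Fin 6 → ℂ := ![1, (δ : ℤ), 1, (ε : ℤ), 1, ((δ * ε : ℤˣ) : ℤ)]

theorem pairSigns_sq (δ ε : ℤˣ) (k : Fin 6) : pairSigns δ ε k ^ 2 = 1 := by
  rcases Int.units_eq_one_or δ with rfl | rfl <;> rcases Int.units_eq_one_or ε with rfl | rfl <;>
    fin_cases k <;> simp [pairSigns]

theorem prod_pairSigns (δ ε : ℤˣ) : ∏ k, pairSigns δ ε k = 1 := by
  rcases Int.units_eq_one_or δ with rfl | rfl <;> rcases Int.units_eq_one_or ε with rfl | rfl <;>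
    simp [pairSigns, Fin.prod_univ_six]

/-- The indices of the sixty planes: a perfect matching of the six coordinates, as in `matching`,
and the signs of its pairs, as in `pairSigns`. -/
abbrev SignedMatching : Type := Fin 5 × Fin 3 × ℤˣ × ℤˣ

theorem card_signedMatching : Nat.card SignedMatching = 60 := by
  simp [Fintype.card_prod]

/-- The parametrization of `plane I` by the values of the first coordinates of the three pairs. -/
noncomputable def planeParametrization : SignedMatching → (Fin 3 → ℂ) →ₗ[ℂ] (Edge 4 → ℂ)
  | (i, j, δ, ε) => oppositeSumsEquiv.symm ∘ₗ LinearMap.pi fun k =>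
      pairSigns δ ε ((matching i j).symm k) • LinearMap.proj (pairIndex ((matching i j).symm k))

/-- The subspace on which the coordinates `oppositeSums` agree along the matching up to the given
signs. -/
noncomputable def plane (I : SignedMatching) : Submodule ℂ (Edge 4 → ℂ) :=
  LinearMap.range (planeParametrization I)

theorem oppositeSums_planeParametrization (i : Fin 5) (j : Fin 3) (δ ε : ℤˣ) (a : Fin 3 → ℂ)
    (k : Fin 6) : oppositeSums (planeParametrization (i, j, δ, ε) a) (matching i j k) =
      pairSigns δ ε k * a (pairIndex k) := by
  refine (congrFun (oppositeSumsEquiv.apply_symm_apply _) (matching i j k)).trans ?_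
  simp

theorem mem_plane_iff {i : Fin 5} {j : Fin 3} {δ ε : ℤˣ} {l : Edge 4 → ℂ} :
    l ∈ plane (i, j, δ, ε) ↔ ∃ a : Fin 3 → ℂ, ∀ k,
      oppositeSums l (matching i j k) = pairSigns δ ε k * a (pairIndex k) := by
  constructor
  · rintro ⟨a, rfl⟩
    exact ⟨a, oppositeSums_planeParametrization i j δ ε a⟩
  · rintro ⟨a, ha⟩
    refine ⟨a, oppositeSumsEquiv.injective <| funext <| (matching i j).surjective.forall.2
      fun k => (oppositeSums_planeParametrization i j δ ε a k).trans (ha k).symm⟩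

theorem planeParametrization_injective (I : SignedMatching) :
    Function.Injective (planeParametrization I) := by
  obtain ⟨i, j, δ, ε⟩ := I
  intro a b hab
  funext m
  have h := oppositeSums_planeParametrization i j δ ε
  have surj : ∀ m, ∃ k, pairIndex k = m := by decide
  obtain ⟨k, rfl⟩ := surj m
  have hk : pairSigns δ ε k ≠ 0 := fun h0 => by simpa [h0] using pairSigns_sq δ ε k
  exact mul_left_cancel₀ hk (by rw [← h a k, ← h b k, hab])

theorem finrank_plane (I : SignedMatching) : Module.finrank ℂ (plane I) = 3 := by
  rw [plane, LinearMap.finrank_range_of_inj (planeParametrization_injective I),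
    Module.finrank_fin_fun]

theorem plane_injective : Function.Injective plane := by
  rintro ⟨i, j, δ, ε⟩ ⟨i', j', δ', ε'⟩ hplane
  let c : Fin 3 → ℂ := ![1, 2, 3]
  have hc (m n : Fin 3) (h : c m ^ 2 = c n ^ 2) : m = n := by
    fin_cases m <;> fin_cases n <;> first | rfl | norm_num [c] at h
  have hl := oppositeSums_planeParametrization i j δ ε c
  obtain ⟨b, hb⟩ := mem_plane_iff.1 <|
    hplane.le (LinearMap.mem_range_self (planeParametrization (i, j, δ, ε)) c)
  generalize planeParametrization (i, j, δ, ε) c = l at hl hb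
  have sq_eq (k : Fin 6) :
      b (pairIndex k) ^ 2 = c (pairIndex ((matching i j).symm (matching i' j' k))) ^ 2 := by
    have := hl ((matching i j).symm (matching i' j' k))
    rw [Equiv.apply_symm_apply, hb] at this
    have := congrArg (· ^ 2) this
    simpa only [mul_pow, pairSigns_sq, one_mul] using this
  obtain ⟨rfl, rfl⟩ := matching_unique fun k m hkm => hc _ _ <| by rw [← sq_eq, ← sq_eq, hkm]
  have h (k : Fin 6) := (hl k).symm.trans (hb k)
  have hb0 : 1 = b 0 := by simpa [pairSigns, pairIndex, c] using h 0
  have hb2 : 2 = b 1 := by simpa [pairSigns, pairIndex, c] using h 2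
  have hδ : δ = δ' := by
    simpa [pairSigns, pairIndex, c, ← hb0, Units.val_inj] using h 1
  have hε : ε = ε' := by
    simpa [pairSigns, pairIndex, c, ← hb2, Units.val_inj] using h 3
  rw [hδ, hε]

theorem IsSignedPairing.exists_matching_signs {y : Fin 6 → ℂ} (hy : IsSignedPairing y) :
    ∃ (i : Fin 5) (j : Fin 3) (δ ε : ℤˣ) (a : Fin 3 → ℂ),
      ∀ k, y (matching i j k) = pairSigns δ ε k * a (pairIndex k) := by
  obtain ⟨τ, r, hr, hprod⟩ := hy
  obtain ⟨i, j, σ, hσ⟩ := exists_matching τ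
  have sq_eq (k : Fin 6) : y (matching i j k) ^ 2 = r (σ (pairIndex k)) := by
    rw [← hσ, ← hr, Equiv.apply_symm_apply]
  let a : Fin 3 → ℂ := ![y (matching i j 0), y (matching i j 2), y (matching i j 4)]
  let b : Fin 3 → ℂ := ![y (matching i j 1), y (matching i j 3), y (matching i j 5)]
  have ha (m : Fin 3) : a m ^ 2 = r (σ m) := by
    fin_cases m
    exacts [sq_eq 0, sq_eq 2, sq_eq 4]
  have hb (m : Fin 3) : b m ^ 2 = r (σ m) := by
    fin_cases m
    exacts [sq_eq 1, sq_eq 3, sq_eq 5]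
  have prod_mul_prod : (∏ m, a m) * ∏ m, b m = (∏ m, a m) ^ 2 := by
    rw [← Finset.prod_pow, Fintype.prod_congr _ _ ha, Equiv.prod_comp σ, ← hprod,
      ← Equiv.prod_comp (matching i j)]
    simp only [Fin.prod_univ_three, Fin.prod_univ_six, a, b, Matrix.cons_val]
    ring
  have prod_eq : ∏ m, b m = ∏ m, a m := by
    have prod_sq : (∏ m, b m) ^ 2 = (∏ m, a m) ^ 2 := by
      simp only [← Finset.prod_pow, ha, hb]
    grind
  obtain ⟨s, hs, hsign⟩ :=
    exists_signs_prod_eq_one (fun m => (hb m).trans (ha m).symm) prod_eq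
  rw [Fin.prod_univ_three] at hs
  have hb2 : b 2 = ((s 0 * s 1 : ℤˣ) : ℤ) * a 2 := by
    rw [eq_inv_of_mul_eq_one_left hs, Int.units_inv_eq_self]
    exact hsign 2
  refine ⟨i, j, s 0, s 1, a, fun k => ?_⟩
  fin_cases k
  exacts [(one_mul _).symm, hsign 0, (one_mul _).symm, hsign 1, (one_mul _).symm, hb2]

theorem isSignedPairing_oppositeSums_iff {l : Edge 4 → ℂ} :
    IsSignedPairing (oppositeSums l) ↔ ∃ I, l ∈ plane I := by
  simp only [Prod.exists, mem_plane_iff]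
  refine ⟨IsSignedPairing.exists_matching_signs, ?_⟩
  rintro ⟨i, j, δ, ε, a, ha⟩
  refine ⟨matching i j, fun m => a m ^ 2, fun k => ?_, ?_⟩
  · rw [ha, mul_pow, pairSigns_sq, one_mul]
  · rw [← Equiv.prod_comp (matching i j), Fintype.prod_congr _ _ ha, Finset.prod_mul_distrib,
      prod_pairSigns, one_mul]
    simp only [pairIndex, Fin.prod_univ_six, Fin.prod_univ_three, Matrix.cons_val]
    ring

end Planes

section Tetrahedra

theorem sextic_sums_differences {R : Type*} [CommRing R] (x y z u v w : R) :
    sextic ![u + x, u - x, v + y, v - y, w + z, w - z] = -96 *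
      (x ^ 2 * u ^ 2 * (y ^ 2 + v ^ 2 + z ^ 2 + w ^ 2 - x ^ 2 - u ^ 2)
        + y ^ 2 * v ^ 2 * (x ^ 2 + u ^ 2 + z ^ 2 + w ^ 2 - y ^ 2 - v ^ 2)
        + z ^ 2 * w ^ 2 * (x ^ 2 + u ^ 2 + y ^ 2 + v ^ 2 - z ^ 2 - w ^ 2)
        - (x ^ 2 * y ^ 2 * z ^ 2 + x ^ 2 * v ^ 2 * w ^ 2 + u ^ 2 * y ^ 2 * w ^ 2
          + u ^ 2 * v ^ 2 * z ^ 2)) := by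
  simp only [sextic, Fin.sum_univ_six, Fin.prod_univ_six, Matrix.cons_val]
  ring

/-- When the face with sides `x`, `y`, `z` is degenerate, the equation of `L 2 4` is, up to a
constant, the square of Stewart's relation. -/
theorem stewart_of_sextic_eq_zero {x y z u v w θ ι : ℂ} (hθ : θ ^ 2 = 1) (hι : ι ^ 2 = 1)
    (hcol : x + θ * y + ι * z = 0)
    (h : sextic ![u + x, u - x, v + y, v - y, w + z, w - z] = 0) :
    x * u ^ 2 + θ * y * v ^ 2 + ι * z * w ^ 2 + θ * ι * x * y * z = 0 := by
  obtain rfl : x = -(θ * y + ι * z) := by linear_combination hcol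
  rw [sextic_sums_differences] at h
  refine pow_eq_zero_iff two_ne_zero |>.1 ?_
  rcases sq_eq_one_iff.1 hθ with rfl | rfl <;>
    rcases sq_eq_one_iff.1 hι with rfl | rfl <;>
    linear_combination (1 / 96) * h

theorem heron_mul_eq_zero_of_sextic_eq_zero {x y z u v w α β γ k : ℂ} (hsum : α + β + γ = 1)
    (hu : u ^ 2 = k + β * z ^ 2 + γ * y ^ 2) (hv : v ^ 2 = k + α * z ^ 2 + γ * x ^ 2)
    (hw : w ^ 2 = k + α * y ^ 2 + β * x ^ 2)
    (h : sextic ![u + x, u - x, v + y, v - y, w + z, w - z] = 0) :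
    (x + y + z) * (-x + y + z) * (x - y + z) * (x + y - z) *
      (k + β * γ * x ^ 2 + γ * α * y ^ 2 + α * β * z ^ 2) = 0 := by
  obtain rfl : γ = 1 - α - β := by linear_combination hsum
  rw [sextic_sums_differences, hu, hv, hw] at h
  linear_combination (-1 / 96) * h

variable {u v w : Fin 3 → ℂ}

/-- The sums and differences of opposite edges of a tetrahedron, one face of which has sides `a`,
when the edges opposite to `a 0`, `a 1`, `a 2` are the linear forms `u`, `v`, `w` in `a`. -/
def sumsDifferences (u v w a : Fin 3 → ℂ) : Fin 6 → ℂ :=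
  ![u ⬝ᵥ a + a 0, u ⬝ᵥ a - a 0, v ⬝ᵥ a + a 1, v ⬝ᵥ a - a 1, w ⬝ᵥ a + a 2, w ⬝ᵥ a - a 2]

theorem stewart_dotProduct (h : ∀ a, sextic (sumsDifferences u v w a) = 0) {θ ι x y z : ℂ}
    (hθ : θ ^ 2 = 1) (hι : ι ^ 2 = 1) (hcol : x + θ * y + ι * z = 0) :
    x * (u 0 * x + u 1 * y + u 2 * z) ^ 2 + θ * y * (v 0 * x + v 1 * y + v 2 * z) ^ 2
      + ι * z * (w 0 * x + w 1 * y + w 2 * z) ^ 2 + θ * ι * x * y * z = 0 := by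
  simpa only [Matrix.vec3_dotProduct, Matrix.cons_val] using
    stewart_of_sextic_eq_zero hθ hι hcol (h ![x, y, z])

theorem mul_eq_mul_and_sq_add_sq_eq (h : ∀ a, sextic (sumsDifferences u v w a) = 0) :
    (u 0 * u 1 = v 0 * v 1 ∧ u 0 ^ 2 + u 1 ^ 2 = v 0 ^ 2 + v 1 ^ 2) ∧
    (u 0 * u 2 = w 0 * w 2 ∧ u 0 ^ 2 + u 2 ^ 2 = w 0 ^ 2 + w 2 ^ 2) ∧
    (v 1 * v 2 = w 1 * w 2 ∧ v 1 ^ 2 + v 2 ^ 2 = w 1 ^ 2 + w 2 ^ 2) := by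
  have xy {t : ℂ} (ht : t ^ 2 = 1) : (u 0 - t * u 1) ^ 2 = (v 0 - t * v 1) ^ 2 := by
    linear_combination stewart_dotProduct h (x := 1) (y := -t) (z := 0) ht (one_pow 2)
      (by linear_combination -ht) + (v 0 - t * v 1) ^ 2 * ht
  have xz {t : ℂ} (ht : t ^ 2 = 1) : (u 0 - t * u 2) ^ 2 = (w 0 - t * w 2) ^ 2 := by
    linear_combination stewart_dotProduct h (x := 1) (y := 0) (z := -t) (one_pow 2) ht
      (by linear_combination -ht) + (w 0 - t * w 2) ^ 2 * ht
  have yz {t : ℂ} (ht : t ^ 2 = 1) : (v 1 - t * v 2) ^ 2 = (w 1 - t * w 2) ^ 2 := by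
    linear_combination stewart_dotProduct h (x := 0) (y := 1) (z := -t) (one_pow 2) ht
      (by linear_combination -ht) + (w 1 - t * w 2) ^ 2 * ht
  have one := one_pow (M := ℂ) 2
  have neg_one : (-1 : ℂ) ^ 2 = 1 := by norm_num
  refine ⟨⟨?_, ?_⟩, ⟨?_, ?_⟩, ⟨?_, ?_⟩⟩
  · linear_combination (xy neg_one - xy one) / 4
  · linear_combination (xy neg_one + xy one) / 2
  · linear_combination (xz neg_one - xz one) / 4
  · linear_combination (xz neg_one + xz one) / 2
  · linear_combination (yz neg_one - yz one) / 4
  · linear_combination (yz neg_one + yz one) / 2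

theorem exists_weights (h : ∀ a, sextic (sumsDifferences u v w a) = 0) :
    ∃ α β γ : ℂ, α + β + γ = 1 ∧ ∀ a : Fin 3 → ℂ,
      (v ⬝ᵥ a) ^ 2 = (u ⬝ᵥ a) ^ 2 + (α - β) * a 2 ^ 2 + γ * (a 0 ^ 2 - a 1 ^ 2) ∧
      (w ⬝ᵥ a) ^ 2 = (u ⬝ᵥ a) ^ 2 + (α - γ) * a 1 ^ 2 + β * (a 0 ^ 2 - a 2 ^ 2) := by
  obtain ⟨⟨uv_cross, uv_sq⟩, ⟨uw_cross, uw_sq⟩, ⟨vw_cross, vw_sq⟩⟩ :=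
    mul_eq_mul_and_sq_add_sq_eq h
  have stewart (θ ι : ℂ) (hθ : θ ^ 2 = 1) (hι : ι ^ 2 = 1) :=
    stewart_dotProduct h (x := 1) (y := θ) (z := -2 * ι) hθ hι (by linear_combination hθ - 2 * hι)
  have one := one_pow (M := ℂ) 2
  have neg_one : (-1 : ℂ) ^ 2 = 1 := by norm_num
  have h₁ := stewart 1 1 one one
  have h₂ := stewart 1 (-1) one neg_one
  have h₃ := stewart (-1) 1 neg_one one
  have h₄ := stewart (-1) (-1) neg_one neg_one
  have cross_xy : u 0 * u 1 + v 0 * v 1 = 2 * w 0 * w 1 := by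
    linear_combination (h₁ + h₂ - h₃ - h₄) / 8
  have cross_xz : u 0 * u 2 + v 0 * v 2 = 2 * w 0 * w 2 := by
    linear_combination (h₂ - h₁ + h₄ - h₃) / 16
  have cross_yz : u 1 * u 2 + v 1 * v 2 = 2 * w 1 * w 2 := by
    linear_combination (h₂ - h₁ + h₃ - h₄) / 16
  refine ⟨w 1 ^ 2 - v 1 ^ 2, w 0 ^ 2 - u 0 ^ 2, v 0 ^ 2 - u 0 ^ 2, ?_, fun a => ?_⟩
  · linear_combination (h₁ + h₂ + h₃ + h₄) / 8 - uv_sq / 2 - 2 * uw_sq - 2 * vw_sq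
  simp only [Matrix.vec3_dotProduct]
  constructor
  · linear_combination (-a 1 ^ 2) * uv_sq + a 2 ^ 2 * (vw_sq - uw_sq)
      - 2 * a 0 * a 1 * uv_cross + 2 * a 0 * a 2 * (cross_xz - 2 * uw_cross)
      + 2 * a 1 * a 2 * (2 * vw_cross - cross_yz)
  · linear_combination (-a 1 ^ 2) * uv_sq - a 2 ^ 2 * uw_sq
      - a 0 * a 1 * (cross_xy + uv_cross) - 2 * a 0 * a 2 * uw_cross
      + 2 * a 1 * a 2 * (vw_cross - cross_yz)

theorem exists_weights_diagonal (h : ∀ a, sextic (sumsDifferences u v w a) = 0) :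
    ∃ α β γ : ℂ, α + β + γ = 1 ∧ ∀ a : Fin 3 → ℂ,
      (u ⬝ᵥ a) ^ 2 = -(β * γ) * a 0 ^ 2 + γ * (1 - α) * a 1 ^ 2 + β * (1 - α) * a 2 ^ 2 ∧
      (v ⬝ᵥ a) ^ 2 = γ * (1 - β) * a 0 ^ 2 + -(γ * α) * a 1 ^ 2 + α * (1 - β) * a 2 ^ 2 ∧
      (w ⬝ᵥ a) ^ 2 = β * (1 - γ) * a 0 ^ 2 + α * (1 - γ) * a 1 ^ 2 + -(α * β) * a 2 ^ 2 := by
  obtain ⟨α, β, γ, hsum, hvw⟩ := exists_weights h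
  have heron (x y z : ℂ) := heron_mul_eq_zero_of_sextic_eq_zero (x := x) (y := y) (z := z)
    (k := (u ⬝ᵥ ![x, y, z]) ^ 2 - β * z ^ 2 - γ * y ^ 2) hsum (by ring)
    (by rw [(hvw ![x, y, z]).1]; simp only [Matrix.cons_val]; ring)
    (by rw [(hvw ![x, y, z]).2]; simp only [Matrix.cons_val]; ring) (h ![x, y, z])
  simp only [Matrix.vec3_dotProduct, Matrix.cons_val] at heron
  have h₀ : u 0 ^ 2 = -(β * γ) := by linear_combination -heron 1 0 0
  have h₁ : u 1 ^ 2 = γ * (1 - α) := by linear_combination -heron 0 1 0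
  have h₂ : u 2 ^ 2 = β * (1 - α) := by linear_combination -heron 0 0 1
  have h₀₁₂ : u 0 * u 1 + u 0 * u 2 + u 1 * u 2 = 0 := by
    linear_combination heron 1 1 1 / 6 - (h₀ + h₁ + h₂) / 2
  have h₀₁ : u 0 * u 1 = 0 := by
    linear_combination heron 1 1 (-1) / 12 - (h₀ + h₁ + h₂) / 4 + h₀₁₂ / 2
  have h₀₂ : u 0 * u 2 = 0 := by
    linear_combination heron 1 (-1) 1 / 12 - (h₀ + h₁ + h₂) / 4 + h₀₁₂ / 2
  have u_sq (a : Fin 3 → ℂ) : (u ⬝ᵥ a) ^ 2 =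
      -(β * γ) * a 0 ^ 2 + γ * (1 - α) * a 1 ^ 2 + β * (1 - α) * a 2 ^ 2 := by
    rw [Matrix.vec3_dotProduct]
    linear_combination a 0 ^ 2 * h₀ + a 1 ^ 2 * h₁ + a 2 ^ 2 * h₂ + 2 * a 0 * a 1 * h₀₁ +
      2 * a 0 * a 2 * h₀₂ + 2 * a 1 * a 2 * (h₀₁₂ - h₀₁ - h₀₂)
  refine ⟨α, β, γ, hsum, fun a => ⟨u_sq a, ?_, ?_⟩⟩
  · rw [(hvw a).1, u_sq]
    obtain rfl : γ = 1 - α - β := by linear_combination hsum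
    ring
  · rw [(hvw a).2, u_sq]
    obtain rfl : γ = 1 - α - β := by linear_combination hsum
    ring

theorem mul_eq_zero_of_sq_dotProduct_eq {p q r : ℂ}
    (h : ∀ a : Fin 3 → ℂ, (u ⬝ᵥ a) ^ 2 = p * a 0 ^ 2 + q * a 1 ^ 2 + r * a 2 ^ 2) :
    q * r = 0 ∧ r * p = 0 ∧ p * q = 0 := by
  have form (x y z : ℂ) := h ![x, y, z]
  simp only [Matrix.vec3_dotProduct, Matrix.cons_val] at form
  have h₀ : u 0 ^ 2 = p := by linear_combination form 1 0 0
  have h₁ : u 1 ^ 2 = q := by linear_combination form 0 1 0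
  have h₂ : u 2 ^ 2 = r := by linear_combination form 0 0 1
  have h₁₂ : u 1 * u 2 = 0 := by linear_combination (form 0 1 1 - h₁ - h₂) / 2
  have h₂₀ : u 2 * u 0 = 0 := by linear_combination (form 1 0 1 - h₂ - h₀) / 2
  have h₀₁ : u 0 * u 1 = 0 := by linear_combination (form 1 1 0 - h₀ - h₁) / 2
  rw [← h₀, ← h₁, ← h₂, ← mul_pow, ← mul_pow, ← mul_pow, h₁₂, h₂₀, h₀₁]
  simp only [zero_pow two_ne_zero, and_self]

theorem weights_eq_one_zero_zero {α β γ : ℂ} (hsum : α + β + γ = 1)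
    (hα : β * γ * (1 - α) = 0) (hβ : γ * α * (1 - β) = 0) (hγ : α * β * (1 - γ) = 0) :
    (α = 1 ∧ β = 0 ∧ γ = 0) ∨ (α = 0 ∧ β = 1 ∧ γ = 0) ∨ (α = 0 ∧ β = 0 ∧ γ = 1) := by
  grind

theorem eq_zero_and_sq_eq_of_sextic_eq_zero (h : ∀ a, sextic (sumsDifferences u v w a) = 0) :
    (∀ a, u ⬝ᵥ a = 0 ∧ (v ⬝ᵥ a) ^ 2 = a 2 ^ 2 ∧ (w ⬝ᵥ a) ^ 2 = a 1 ^ 2) ∨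
    (∀ a, v ⬝ᵥ a = 0 ∧ (w ⬝ᵥ a) ^ 2 = a 0 ^ 2 ∧ (u ⬝ᵥ a) ^ 2 = a 2 ^ 2) ∨
    (∀ a, w ⬝ᵥ a = 0 ∧ (u ⬝ᵥ a) ^ 2 = a 1 ^ 2 ∧ (v ⬝ᵥ a) ^ 2 = a 0 ^ 2) := by
  obtain ⟨α, β, γ, hsum, hsq⟩ := exists_weights_diagonal h
  have hu := mul_eq_zero_of_sq_dotProduct_eq fun a => (hsq a).1
  have hv := mul_eq_zero_of_sq_dotProduct_eq fun a => (hsq a).2.1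
  have hw := mul_eq_zero_of_sq_dotProduct_eq fun a => (hsq a).2.2
  have hα : β * γ * (1 - α) = 0 := by
    refine pow_eq_zero_iff two_ne_zero |>.1 ?_
    linear_combination β * γ * hu.1
  have hβ : γ * α * (1 - β) = 0 := by
    refine pow_eq_zero_iff two_ne_zero |>.1 ?_
    linear_combination γ * α * hv.2.1
  have hγ : α * β * (1 - γ) = 0 := by
    refine pow_eq_zero_iff two_ne_zero |>.1 ?_
    linear_combination α * β * hw.2.2
  rcases weights_eq_one_zero_zero hsum hα hβ hγ with
    ⟨rfl, rfl, rfl⟩ | ⟨rfl, rfl, rfl⟩ | ⟨rfl, rfl, rfl⟩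
  · exact .inl fun a => by simpa using hsq a
  · refine .inr <| .inl fun a => ?_
    obtain ⟨hu, hv, hw⟩ := hsq a
    exact ⟨by simpa using hv, by simpa using hw, by simpa using hu⟩
  · refine .inr <| .inr fun a => ?_
    obtain ⟨hu, hv, hw⟩ := hsq a
    exact ⟨by simpa using hw, by simpa using hu, by simpa using hv⟩

end Tetrahedra

section SignedPermutations

theorem sextic_signedPerm {R : Type*} [CommRing R] {s : Fin 6 → R} (hs : ∀ k, s k ^ 2 = 1)
    (hprod : ∏ k, s k = 1) (ρ : Equiv.Perm (Fin 6)) (y : Fin 6 → R) :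
    sextic (fun k => s k * y (ρ k)) = sextic y := by
  have sum_pow (n : ℕ) : ∑ k, (s k * y (ρ k)) ^ (2 * n) = ∑ k, y k ^ (2 * n) := by
    simp only [mul_pow, pow_mul, hs, one_mul, Equiv.sum_comp ρ fun k => (y k ^ 2) ^ n]
  have prod_eq : ∏ k, s k * y (ρ k) = ∏ k, y k := by
    rw [Finset.prod_mul_distrib, hprod, one_mul, Equiv.prod_comp ρ]
  simp only [sextic, prod_eq, sum_pow 1, sum_pow 2, sum_pow 3]

theorem IsSignedPairing.of_signedPerm {s y : Fin 6 → ℂ} {ρ : Equiv.Perm (Fin 6)}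
    (hs : ∀ k, s k ^ 2 = 1) (hprod : ∏ k, s k = 1)
    (h : IsSignedPairing fun k => s k * y (ρ k)) : IsSignedPairing y := by
  obtain ⟨τ, r, hr, hy⟩ := h
  refine ⟨ρ * τ, r, fun k => ?_, ?_⟩
  · simpa only [mul_pow, hs, one_mul, Equiv.Perm.mul_apply] using hr k
  · rwa [Finset.prod_mul_distrib, hprod, one_mul, Equiv.prod_comp ρ] at hy

theorem isSignedPairing_of_sq_eq_sq (x : ℂ) {y z v w : ℂ} (hv : v ^ 2 = z ^ 2)
    (hw : w ^ 2 = y ^ 2) : IsSignedPairing ![0 + x, 0 - x, v + y, v - y, w + z, w - z] := by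
  have hprod : ∏ k, ![0 + x, 0 - x, v + y, v - y, w + z, w - z] k =
      ∏ m, ![x ^ 2, (v + y) ^ 2, (v - y) ^ 2] m := by
    simp only [Fin.prod_univ_six, Fin.prod_univ_three, Matrix.cons_val]
    linear_combination -x ^ 2 * (v ^ 2 - y ^ 2) * (hv + hw)
  have zero_sub_sq : (0 - x) ^ 2 = x ^ 2 := by ring
  have prod_sq : (w * z) ^ 2 = (v * y) ^ 2 := by rw [mul_pow, mul_pow, hv, hw, mul_comm]
  rcases sq_eq_sq_iff_eq_or_eq_neg.1 prod_sq with h | h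
  · have swap_sq : (w + z) ^ 2 = (v + y) ^ 2 := by linear_combination hw - hv + 2 * h
    have swap_sq' : (w - z) ^ 2 = (v - y) ^ 2 := by linear_combination hw - hv - 2 * h
    refine ⟨Equiv.swap 3 4, _, fun k => ?_, hprod⟩
    fin_cases k
    exacts [congrArg (· ^ 2) (zero_add x), zero_sub_sq, rfl, swap_sq, rfl, swap_sq']
  · have swap_sq : (w + z) ^ 2 = (v - y) ^ 2 := by linear_combination hw - hv + 2 * h
    have swap_sq' : (w - z) ^ 2 = (v + y) ^ 2 := by linear_combination hw - hv - 2 * h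
    refine ⟨Equiv.swap 3 5, _, fun k => ?_, hprod⟩
    fin_cases k
    exacts [congrArg (· ^ 2) (zero_add x), zero_sub_sq, rfl, swap_sq', swap_sq, rfl]

theorem isSignedPairing_sumsDifferences {u v w : Fin 3 → ℂ}
    (h : ∀ a, sextic (sumsDifferences u v w a) = 0) (a : Fin 3 → ℂ) :
    IsSignedPairing (sumsDifferences u v w a) := by
  have rotate {y : Fin 6 → ℂ} (n : Fin 6) (hy : IsSignedPairing fun k => y (k + n)) :
      IsSignedPairing y :=
    .of_signedPerm (s := 1) (ρ := Equiv.addRight n) (fun _ => one_pow 2)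
      (Finset.prod_const_one) (by simpa using hy)
  rcases eq_zero_and_sq_eq_of_sextic_eq_zero h with h | h | h
  all_goals obtain ⟨hzero, hsq, hsq'⟩ := h a
  · rw [sumsDifferences, hzero]
    exact isSignedPairing_of_sq_eq_sq (a 0) hsq hsq'
  · refine rotate 2 ?_
    convert isSignedPairing_of_sq_eq_sq (a 1) hsq hsq' using 1
    funext k
    fin_cases k <;> simp [sumsDifferences, hzero]
  · refine rotate 4 ?_
    convert isSignedPairing_of_sq_eq_sq (a 2) hsq hsq' using 1
    funext k
    fin_cases k <;> simp [sumsDifferences, hzero]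

end SignedPermutations

section Coordinates

open Matrix

theorem exists_det_submatrix_ne_zero {K m : Type*} [Field K] [Finite m] {n : ℕ}
    {A : Matrix m (Fin n) K} (hA : A.rank = n) :
    ∃ e : Fin n ↪ m, (A.submatrix e id).det ≠ 0 := by
  rw [rank_eq_finrank_span_row] at hA
  obtain ⟨f, hf, -, hind⟩ := Submodule.exists_fun_fin_finrank_span_eq K (Set.range A.row)
  choose e he using hf
  obtain rfl : A.row ∘ e = f := funext he
  have hrow : LinearIndependent K (A.submatrix (e ∘ Fin.cast hA.symm) id).row :=
    hind.comp _ (Fin.cast_injective hA.symm)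
  refine ⟨⟨e ∘ Fin.cast hA.symm, fun i j hij => hrow.injective (congrArg A hij)⟩, ?_⟩
  exact ((isUnit_iff_isUnit_det _).1 (linearIndependent_rows_iff_isUnit.1 hrow)).ne_zero

theorem exists_det_sub_diagonal_mul_ne_zero {P Q : Matrix (Fin 3) (Fin 3) ℂ} (h : P.det ≠ Q.det) :
    ∃ δ ε : ℤˣ, (P - diagonal ![((δ : ℤ) : ℂ), (ε : ℤ), ((δ * ε : ℤˣ) : ℤ)] * Q).det ≠ 0 := by
  contrapose! h
  have h₁ := h 1 1
  have h₂ := h 1 (-1)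
  have h₃ := h (-1) 1
  have h₄ := h (-1) (-1)
  simp only [det_fin_three, Matrix.sub_apply, diagonal_mul, cons_val] at h₁ h₂ h₃ h₄ ⊢
  push_cast at h₁ h₂ h₃ h₄
  linear_combination (h₁ + h₂ + h₃ + h₄) / 4

theorem exists_perm_det_submatrix_ne {A : Matrix (Fin 6) (Fin 3) ℂ} (hA : A.rank = 3) :
    ∃ τ : Equiv.Perm (Fin 6),
      (A.submatrix (τ ∘ ![0, 2, 4]) id).det ≠ (A.submatrix (τ ∘ ![1, 3, 5]) id).det := by
  obtain ⟨e, he⟩ := exists_det_submatrix_ne_zero hA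
  obtain ⟨τ, hτ⟩ := Equiv.Perm.exists_extending_pair ![0, 2, 4] e (by decide) e.injective
  replace hτ : τ ∘ ![0, 2, 4] = e := funext hτ
  by_contra! h
  have hswap := h (τ * Equiv.swap 0 2)
  have hevens : ⇑(τ * Equiv.swap (0 : Fin 6) 2) ∘ ![0, 2, 4] = e ∘ Equiv.swap 0 1 := by
    rw [← hτ, Equiv.Perm.coe_mul, Function.comp_assoc, Function.comp_assoc]
    congr 1
    decide
  have hodds : ⇑(τ * Equiv.swap (0 : Fin 6) 2) ∘ ![1, 3, 5] = τ ∘ ![1, 3, 5] := by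
    rw [Equiv.Perm.coe_mul, Function.comp_assoc]
    congr 1
    decide
  rw [hevens, hodds, ← h τ, hτ] at hswap
  have hneg : (A.submatrix (e ∘ Equiv.swap 0 1) id).det = -(A.submatrix e id).det := by
    simpa [Equiv.Perm.sign_swap] using det_permute (Equiv.swap 0 1) (A.submatrix e id)
  exact he (self_eq_neg.1 (hswap.symm.trans hneg))

theorem exists_surjective_eq_sumsDifferences {P Q : Matrix (Fin 3) (Fin 3) ℂ}
    (h : (P - Q).det ≠ 0) :
    ∃ (u v w : Fin 3 → ℂ) (T : (Fin 3 → ℂ) → (Fin 3 → ℂ)), T.Surjective ∧ ∀ c,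
      ![(P *ᵥ c) 0, (Q *ᵥ c) 0, (P *ᵥ c) 1, (Q *ᵥ c) 1, (P *ᵥ c) 2, (Q *ᵥ c) 2] =
        sumsDifferences u v w (T c) := by
  have hunit : IsUnit (P - Q).det := isUnit_iff_ne_zero.2 h
  let U := (P + Q) * (P - Q)⁻¹
  let T (c : Fin 3 → ℂ) : Fin 3 → ℂ := (2⁻¹ : ℂ) • ((P - Q) *ᵥ c)
  refine ⟨U.row 0, U.row 1, U.row 2, T, fun a => ⟨(2 : ℂ) • ((P - Q)⁻¹ *ᵥ a), ?_⟩, fun c => ?_⟩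
  · simp only [T, mulVec_smul, mulVec_mulVec, mul_nonsing_inv _ hunit, one_mulVec, smul_smul,
      inv_mul_cancel₀ (two_ne_zero' ℂ), one_smul]
  have half_sum : U *ᵥ T c = (2⁻¹ : ℂ) • ((P + Q) *ᵥ c) := by
    simp only [U, T, mulVec_smul, mulVec_mulVec, Matrix.mul_assoc, nonsing_inv_mul _ hunit,
      Matrix.mul_one]
  have hU (i : Fin 3) : U.row i ⬝ᵥ T c = ((P *ᵥ c) i + (Q *ᵥ c) i) / 2 := by
    refine (congrFun half_sum i).trans ?_
    simp only [Pi.smul_apply, smul_eq_mul, add_mulVec, Pi.add_apply]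
    ring
  have hT (i : Fin 3) : T c i = ((P *ᵥ c) i - (Q *ᵥ c) i) / 2 := by
    simp only [T, Pi.smul_apply, smul_eq_mul, sub_mulVec, Pi.sub_apply]
    ring
  simp only [sumsDifferences, hU, hT]
  congr! <;> ring

theorem isSignedPairing_mulVec_of_sextic_eq_zero {A : Matrix (Fin 6) (Fin 3) ℂ} (hA : A.rank = 3)
    (h : ∀ c, sextic (A *ᵥ c) = 0) (c : Fin 3 → ℂ) : IsSignedPairing (A *ᵥ c) := by
  obtain ⟨τ, hτ⟩ := exists_perm_det_submatrix_ne hA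
  obtain ⟨δ, ε, hdet⟩ := exists_det_sub_diagonal_mul_ne_zero hτ
  obtain ⟨u, v, w, T, hT, heq⟩ := exists_surjective_eq_sumsDifferences hdet
  have signedPerm_eq (c : Fin 3 → ℂ) :
      (fun k => pairSigns δ ε k * (A *ᵥ c) (τ k)) = sumsDifferences u v w (T c) := by
    rw [← heq]
    simp only [← mulVec_mulVec, mulVec_diagonal]
    funext k
    fin_cases k
    exacts [one_mul _, rfl, one_mul _, rfl, one_mul _, rfl]
  refine .of_signedPerm (pairSigns_sq δ ε) (prod_pairSigns δ ε) (ρ := τ) ?_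
  rw [signedPerm_eq]
  refine isSignedPairing_sumsDifferences (hT.forall.2 fun c => ?_) _
  rw [← signedPerm_eq, sextic_signedPerm (pairSigns_sq δ ε) (prod_pairSigns δ ε), h]

end Coordinates

section Subspaces

theorem exists_le_finrank_eq {K V : Type*} [Field K] [AddCommGroup V] [Module K V]
    [FiniteDimensional K V] {U W : Submodule K V} (hUW : U ≤ W) {n : ℕ}
    (hU : Module.finrank K U ≤ n) (hW : n ≤ Module.finrank K W) :
    ∃ U', U ≤ U' ∧ U' ≤ W ∧ Module.finrank K U' = n := by
  induction n, hU using Nat.le_induction with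
  | base => exact ⟨U, le_rfl, hUW, rfl⟩
  | succ n _ ih =>
    obtain ⟨U', hUU', hU'W, rfl⟩ := ih (Nat.le_of_succ_le hW)
    obtain ⟨w, hw, hw'⟩ := SetLike.exists_of_lt (lt_of_le_of_ne hU'W (by rintro rfl; omega))
    exact ⟨U' ⊔ K ∙ w, hUU'.trans le_sup_left,
      sup_le hU'W ((Submodule.span_singleton_le_iff_mem _ _).2 hw),
      Submodule.finrank_sup_span_singleton hw'⟩

theorem isSignedPairing_of_mem_of_finrank_eq_three {W : Submodule ℂ (Edge 4 → ℂ)}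
    (hW : Module.finrank ℂ W = 3) (hL : (W : Set (Edge 4 → ℂ)) ⊆ L 2 4) {l : Edge 4 → ℂ}
    (hl : l ∈ W) : IsSignedPairing (oppositeSums l) := by
  let b := Module.finBasisOfFinrankEq ℂ W hW
  let A : Matrix (Fin 6) (Fin 3) ℂ := (Matrix.of fun m => oppositeSumsEquiv (b m)).transpose
  have hrank : A.rank = 3 := by
    rw [Matrix.rank_transpose]
    refine (LinearIndependent.rank_matrix ?_).trans (Fintype.card_fin 3)
    exact (b.linearIndependent.map' W.subtype W.ker_subtype).map' oppositeSumsEquiv.toLinearMap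
      oppositeSumsEquiv.ker
  have hA (c : Fin 3 → ℂ) : A.mulVec c = oppositeSums (b.equivFun.symm c : Edge 4 → ℂ) := by
    change _ = oppositeSumsEquiv _
    rw [Matrix.mulVec_transpose, Matrix.vecMul_eq_sum, Module.Basis.equivFun_symm_apply,
      AddSubmonoidClass.coe_finsetSum, map_sum]
    exact Finset.sum_congr rfl fun m _ => (map_smul oppositeSumsEquiv (c m) _).symm
  have := isSignedPairing_mulVec_of_sextic_eq_zero hrank
    (fun c => by rw [hA, ← mem_L_iff]; exact hL (b.equivFun.symm c).2) (b.equivFun ⟨l, hl⟩)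
  rwa [hA, LinearEquiv.symm_apply_apply] at this

theorem exists_le_plane_of_subset_L {W : Submodule ℂ (Edge 4 → ℂ)} (hW : 3 ≤ Module.finrank ℂ W)
    (hL : (W : Set (Edge 4 → ℂ)) ⊆ L 2 4) : ∃ I, W ≤ plane I := by
  have mem_plane (l : W) : ∃ I, l.1 ∈ plane I := by
    rw [← isSignedPairing_oppositeSums_iff]
    obtain ⟨U, hlU, hUW, hU⟩ := exists_le_finrank_eq
      ((Submodule.span_singleton_le_iff_mem l.1 W).2 l.2)
      ((finrank_span_le_card {l.1}).trans (by simp)) hW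
    exact isSignedPairing_of_mem_of_finrank_eq_three hU (fun x hx => hL (hUW hx))
      (hlU (Submodule.mem_span_singleton_self l.1))
  obtain ⟨I, hI⟩ := Subspace.exists_eq_top_of_iUnion_eq_univ
    (p := fun I => (plane I).comap W.subtype)
    (Set.eq_univ_of_forall fun l => Set.mem_iUnion.2 (mem_plane l))
  exact ⟨I, Submodule.comap_subtype_eq_top.1 hI⟩

theorem singularLocus_L : singularLocus (L 2 4) = ⋃ I, (plane I : Set (Edge 4 → ℂ)) := by
  ext l
  rw [mem_singularLocus_iff, Set.mem_iUnion, exists_congr fun I => SetLike.mem_coe,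
    ← isSignedPairing_oppositeSums_iff]
  exact ⟨isSignedPairing_of_sexticGradient_eq_zero, IsSignedPairing.sexticGradient_eq_zero⟩

theorem subset_L_iff_mem_range_plane {W : Submodule ℂ (Edge 4 → ℂ)}
    (hW : Module.finrank ℂ W = 3) : (W : Set (Edge 4 → ℂ)) ⊆ L 2 4 ↔ W ∈ Set.range plane := by
  constructor
  · intro hL
    obtain ⟨I, hI⟩ := exists_le_plane_of_subset_L hW.ge hL
    exact ⟨I, (Submodule.eq_of_le_of_finrank_eq hI (by rw [hW, finrank_plane])).symm⟩
  · rintro ⟨I, rfl⟩ l hl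
    exact (singularLocus_L.ge (Set.mem_iUnion_of_mem I hl)).1

theorem finrank_le_three_of_subset_L {W : Submodule ℂ (Edge 4 → ℂ)}
    (hL : (W : Set (Edge 4 → ℂ)) ⊆ L 2 4) : Module.finrank ℂ W ≤ 3 := by
  by_contra! hW
  obtain ⟨I, hI⟩ := exists_le_plane_of_subset_L hW.le hL
  exact hW.not_ge ((Submodule.finrank_mono hI).trans_eq (finrank_plane I))

end Subspaces

end UnsquaredMeasurement

theorem mainTheorem6 :
    ∃ S : Set (Submodule ℂ (UnsquaredMeasurement.Edge 4 → ℂ)),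
      S.ncard = 60 ∧
      (∀ W ∈ S, Module.finrank ℂ W = 3) ∧
      (UnsquaredMeasurement.singularLocus (UnsquaredMeasurement.L 2 4) =
        ⋃ W ∈ S, (W : Set (UnsquaredMeasurement.Edge 4 → ℂ))) ∧
      (∀ W : Submodule ℂ (UnsquaredMeasurement.Edge 4 → ℂ), Module.finrank ℂ W = 3 →
        ((W : Set (UnsquaredMeasurement.Edge 4 → ℂ)) ⊆ UnsquaredMeasurement.L 2 4 ↔ W ∈ S)) ∧
      (∀ W : Submodule ℂ (UnsquaredMeasurement.Edge 4 → ℂ), 4 ≤ Module.finrank ℂ W →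
        ¬ (W : Set (UnsquaredMeasurement.Edge 4 → ℂ)) ⊆ UnsquaredMeasurement.L 2 4) := by
  open UnsquaredMeasurement in
  refine ⟨Set.range plane, ?_, Set.forall_mem_range.2 finrank_plane, ?_,
    fun W => subset_L_iff_mem_range_plane, fun W hW hL => ?_⟩
  · rw [← Set.image_univ, Set.ncard_image_of_injective _ plane_injective, Set.ncard_univ,
      card_signedMatching]
  · rw [singularLocus_L, Set.biUnion_range]
  · exact absurd (hW.trans (finrank_le_three_of_subset_L hL)) (by norm_num)
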